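/- Let $\Omega\subset\mathbb C$ be a bounded domain whose boundary is the disjoint union of finitely many simple closed analytic curves, let $m$ be the number of bounded components of $\mathbb C\setminus\Omega$, and let $p_1,\dots,p_m$ be points, one in each of these components. Let $\mathcal A(\Omega)$ be the closure, in the supremum norm, of the algebra $\mathrm{Rat}(\Omega)$ of rational functions without poles on $\overline\Omega$. For $\boldsymbol\alpha=(\alpha_1,\dots,\alpha_m)\in\mathbb T^m$ let $H^2_{\boldsymbol\alpha}(\Omega)$ be the Hilbert space of those multivalued holomorphic functions $F$ on $\Omega$ that are multiplied by $\prod_j\alpha_j^{n_j}$ under continuation along a loop with winding number $n_j$ around $p_j$ for each $j$ (modulus automorphic functions of index $\boldsymbol\alpha$; they are single-valued functions on the covering surface $\widetilde\Omega$ of pairs $(z,\zeta)$, where $z\in\Omega$ and $\zeta\in\mathbb C^m$, $e^{\zeta_j}=z-p_j$) and for which the single-valued function $|F|^2$ has a harmonic majorant on $\Omega$. The norm is taken with respect to a fixed but arbitrary base point $t\in\Omega$: $\|F\|^2$ is the infimum of $u(t)$ over all harmonic $u\ge|F|^2$ on $\Omega$. Let $K_{\boldsymbol\alpha}$ be its reproducing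 kernel, a function on $\widetilde\Omega\times\widetilde\Omega$, and let $M$ be multiplication by $z$ on $H^2_{\boldsymbol\alpha}(\Omega)$. Let $T$ be a linear transformation of an $n$-dimensional complex Hilbert space $V$ with distinct eigenvalues $z_1,\dots,z_n\in\Omega$, and let $v_i\ne0$ satisfy $T^*v_i=\bar z_iv_i$. Put $\sigma=\{z_1,\dots,z_n\}$ and define $K:\sigma\times\sigma\to\mathbb C$ by $K(z_j,z_i)=\langle v_i,v_j\rangle$ (inner products are linear in the first variable). Suppose that, for some $\boldsymbol\alpha\in\mathbb T^m$ and some choice of points $x_i\in\widetilde\Omega$ over $z_i$ (that is, of branches at the points of $\sigma$), there is a positive semidefinite matrix $A=(a_{ij})$ such that $K$ is the Schur product of $A$ and the restriction of $K_{\boldsymbol\alpha}$ to $\sigma\times\sigma$: $$K(z_j,z_i)=a_{ij}\,K_{\boldsymbol\alpha}(x_j,x_i)\qquad(1\le i,j\le n).$$ Then the operators $T$ on $V$ and $M\otimes I$ on $H^2_{\boldsymbol\alpha}(\Omega)\otimes\mathbb C^n$ induce continuous unital homomorphisms $\rho_T$ and $\rho_{M\otimes I}$ of $\mathcal A(\Omega)$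 (the continuous extensions of $p/q\mapsto p(T)q(T)^{-1}$ and of $p/q\mapsto p(M\otimes I)q(M\otimes I)^{-1}$ from $\mathrm{Rat}(\Omega)$), and $\rho_T$ dilates to $\rho_{M\otimes I}$: there is an isometry $\Gamma:V\to H^2_{\boldsymbol\alpha}(\Omega)\otimes\mathbb C^n$ with $\rho_T(f)=\Gamma^*\rho_{M\otimes I}(f)\,\Gamma$ for all $f\in\mathcal A(\Omega)$. -/

import Mathlib

/- Part 1. Auxiliary facts on harmonic functions in plane open sets (Poisson integral, maximum
principle, Harnack inequality, a harmonic function between a subharmonic and a superharmonic one).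
They serve only to prove that the norm of `HardySpace` below is a complete Hilbert space norm. -/

namespace Potential
open Complex Metric Set Filter Topology InnerProductSpace Real

/-- Poisson integral over the circle of centre `c` and radius `R`. -/
noncomputable def poisson (c : ℂ) (R : ℝ) (f : ℂ → ℝ) (w : ℂ) : ℝ :=
  Real.circleAverage (poissonKernel c w • f) c R

theorem poissonKernel_nonneg {c w z : ℂ} {R : ℝ} (hz : z ∈ sphere c R) (hw : w ∈ ball c R) :
    0 ≤ poissonKernel c w z := by
  rw [poissonKernel_def]
  have h1 : ‖z - c‖ = R := by simpa using hz
  have h2 : ‖w - c‖ < R := by simpa [dist_eq_norm] using hw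
  have := norm_nonneg (w - c)
  apply div_nonneg _ (by positivity)
  rw [h1]; nlinarith

theorem poissonKernel_integrable {f : ℂ → ℝ} {c w : ℂ} {R : ℝ} (hw : w ∈ ball c R)
    (hf : CircleIntegrable f c R) : CircleIntegrable (poissonKernel c w • f) c R := by
  rw [poissonKernel_eq_re_herglotzRieszKernel]
  exact hf.continuousOn_smul
    (continuous_re.comp_continuousOn (continuousOn_herglotzRieszKernel_sphere hw))

theorem poisson_harmonic {f : ℂ → ℝ} {c : ℂ} {R : ℝ} (hf : CircleIntegrable f c R) :
    HarmonicOnNhd (poisson c R f) (ball c R) := by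
  intro w hw
  set g : ℂ → ℝ := fun z => f (z + c) with hg
  have hgi : CircleIntegrable g 0 R := by
    simpa [CircleIntegrable, hg, circleMap, add_comm] using hf
  have hgi' : CircleIntegrable (fun ζ => (g ζ : ℂ)) 0 R := by
    simp only [CircleIntegrable, intervalIntegrable_iff] at hgi ⊢
    exact Complex.ofRealCLM.integrable_comp hgi
  have hA := analyticOnNhd_circleAverage_herglotzRieszKernel_smul hgi'
  set G : ℂ → ℂ := fun w ↦ circleAverage (fun ζ ↦ herglotzRieszKernel 0 w ζ • (g ζ : ℂ)) 0 R
  have hw0 : w - c ∈ ball (0 : ℂ) R := by simpa [dist_eq_norm] using hw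
  have hGc : AnalyticAt ℂ (fun w => G (w - c)) w :=
    AnalyticAt.fun_comp (hA (w - c) hw0) (analyticAt_id.sub analyticAt_const)
  refine (harmonicAt_congr_nhds ?_).2 hGc.harmonicAt_re
  filter_upwards [isOpen_ball.mem_nhds hw] with x hx
  have hx0 : x - c ∈ ball (0 : ℂ) R := by simpa [dist_eq_norm] using hx
  change _ = (G (x - c)).re
  rw [re_circleAverage_herglotzRieszKernel_smul hgi hx0, poisson, ← circleAverage_map_add_const]
  congr 1
  ext z
  simp [poissonKernel_eq_re_herglotzRieszKernel, herglotzRieszKernel_add_const, hg]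

theorem poisson_mono {f g : ℂ → ℝ} {c w : ℂ} {R : ℝ} (hw : w ∈ ball c R)
    (hf : CircleIntegrable f c R) (hg : CircleIntegrable g c R)
    (h : ∀ z ∈ sphere c R, f z ≤ g z) : poisson c R f w ≤ poisson c R g w := by
  have hR : 0 < R := pos_of_mem_ball hw
  refine circleAverage_mono (poissonKernel_integrable hw hf) (poissonKernel_integrable hw hg) ?_
  intro z hz
  rw [abs_of_pos hR] at hz
  exact mul_le_mul_of_nonneg_left (h z hz) (poissonKernel_nonneg hz hw)

theorem poisson_add {f g : ℂ → ℝ} {c w : ℂ} {R : ℝ} (hw : w ∈ ball c R)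
    (hf : CircleIntegrable f c R) (hg : CircleIntegrable g c R) :
    poisson c R (f + g) w = poisson c R f w + poisson c R g w := by
  rw [poisson, smul_add]
  exact circleAverage_add (poissonKernel_integrable hw hf) (poissonKernel_integrable hw hg)

theorem poisson_const {c w : ℂ} {R : ℝ} (hw : w ∈ ball c R) (a : ℝ) :
    poisson c R (fun _ => a) w = a :=
  HarmonicContOnCl.circleAverage_poissonKernel_smul (harmonicContOnCl_const) hw

/-- Continuous data on a circle are uniformly approximated by harmonic functions. -/
theorem exists_harmonic_approx {f : ℂ → ℝ} {c : ℂ} {R : ℝ} (hR : 0 < R)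
    (hf : ContinuousOn f (sphere c R)) {ε : ℝ} (hε : 0 < ε) :
    ∃ q : ℂ → ℝ, HarmonicContOnCl q (ball c R) ∧ ∀ z ∈ sphere c R, |f z - q z| ≤ ε := by
  have : Fact (0 < 2 * Real.pi) := ⟨Real.two_pi_pos⟩
  -- the parametrisation of the circle by `AddCircle (2 * π)`
  have hper : Function.Periodic (fun θ : ℝ => circleMap c R θ) (2 * Real.pi) :=
    periodic_circleMap c R
  let e : AddCircle (2 * Real.pi) → ℂ := hper.lift
  have he : Continuous e := continuous_coinduced_dom.mpr (continuous_circleMap c R)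
  have hes : ∀ a, e a ∈ sphere c R := by
    intro a; induction a using QuotientAddGroup.induction_on with
    | H x => exact circleMap_mem_sphere c hR.le x
  let F : C(AddCircle (2 * Real.pi), ℂ) :=
    ⟨fun a => (f (e a) : ℂ), continuous_ofReal.comp (hf.comp_continuous he hes)⟩
  have key : ∀ G ∈ Submodule.span ℂ (range (@fourier (2 * Real.pi))), ∀ d : ℂ,
      ∃ q : ℂ → ℝ, HarmonicContOnCl q (ball c R) ∧ ∀ a, q (e a) = (d * G a).re := by
    intro G hG
    induction hG using Submodule.span_induction with
    | mem x hx =>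
      intro d
      obtain ⟨n, rfl⟩ := hx
      have hharm : ∀ (d : ℂ) (k : ℕ), HarmonicContOnCl
          (fun z => (d * ((z - c) / R) ^ k).re) (ball c R) := by
        intro d k
        apply HarmonicOnNhd.harmonicContOnCl
        intro z _
        exact AnalyticAt.harmonicAt_re (f := fun z => d * ((z - c) / R) ^ k) (by fun_prop)
      have hR' : (R : ℂ) ≠ 0 := by exact_mod_cast hR.ne'
      rcases Int.eq_nat_or_neg n with ⟨k, rfl | rfl⟩
      · refine ⟨_, hharm d k, fun a => ?_⟩
        induction a using QuotientAddGroup.induction_on with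
        | H x =>
          have : e (x : AddCircle (2 * Real.pi)) = circleMap c R x := rfl
          change (d * ((e (x : AddCircle (2 * Real.pi)) - c) / R) ^ k).re = (d * fourier _ (x : AddCircle (2 * Real.pi))).re
          rw [this, fourier_coe_apply]
          simp only [circleMap, add_sub_cancel_left]
          rw [mul_div_cancel_left₀ _ hR', ← Complex.exp_nat_mul]
          congr 3
          have : (Real.pi : ℂ) ≠ 0 := by exact_mod_cast Real.pi_ne_zero
          push_cast
          field_simp
      · refine ⟨_, hharm (starRingEnd ℂ d) k, fun a => ?_⟩
        induction a using QuotientAddGroup.induction_on with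
        | H x =>
          have : e (x : AddCircle (2 * Real.pi)) = circleMap c R x := rfl
          change ((starRingEnd ℂ d) * ((e (x : AddCircle (2 * Real.pi)) - c) / R) ^ k).re = (d * fourier _ (x : AddCircle (2 * Real.pi))).re
          rw [this, fourier_coe_apply]
          simp only [circleMap, add_sub_cancel_left]
          rw [mul_div_cancel_left₀ _ hR', ← Complex.exp_nat_mul, ← Complex.conj_re, map_mul,
            Complex.conj_conj, ← Complex.exp_conj]
          congr 3
          have : (Real.pi : ℂ) ≠ 0 := by exact_mod_cast Real.pi_ne_zero
          simp only [map_mul, map_natCast, conj_ofReal, conj_I]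
          push_cast
          field_simp
    | zero => exact fun d => ⟨fun _ => 0, harmonicContOnCl_const, by simp⟩
    | add x y _ _ hx hy =>
      intro d
      obtain ⟨q, hq, h1⟩ := hx d
      obtain ⟨r, hr, h2⟩ := hy d
      exact ⟨q + r, hq.add hr, fun a => by simp [h1, h2, mul_add]⟩
    | smul a x _ hx =>
      intro d
      obtain ⟨q, hq, h1⟩ := hx (d * a)
      exact ⟨q, hq, fun b => by simp [h1, mul_assoc]⟩
  have hF : F ∈ closure ((Submodule.span ℂ (range (@fourier (2 * Real.pi))) : Set C(AddCircle (2 * Real.pi), ℂ))) := by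
    have := span_fourier_closure_eq_top (T := 2 * Real.pi)
    have h2 : F ∈ (Submodule.span ℂ (range (@fourier (2 * Real.pi)))).topologicalClosure := by
      rw [this]; trivial
    exact h2
  obtain ⟨G, hG, hd⟩ := Metric.mem_closure_iff.1 hF ε hε
  obtain ⟨q, hq, h1⟩ := key G hG 1
  refine ⟨q, hq, fun z hz => ?_⟩
  have hz' : z ∈ sphere c |R| := by rwa [abs_of_pos hR]
  rw [← range_circleMap] at hz'
  obtain ⟨θ, rfl⟩ := hz'
  have h3 : q (circleMap c R θ) = (G (θ : AddCircle (2 * Real.pi))).re := by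
    have h2 := h1 (θ : AddCircle (2 * Real.pi))
    rw [one_mul] at h2
    exact h2
  have h4 : F (θ : AddCircle (2 * Real.pi)) = (f (circleMap c R θ) : ℂ) := rfl
  have h5 := (ContinuousMap.dist_lt_iff hε).1 hd (θ : AddCircle (2 * Real.pi))
  rw [h3]
  calc |f (circleMap c R θ) - (G (θ : AddCircle (2 * Real.pi))).re|
      = |((F (θ : AddCircle (2 * Real.pi))) - G (θ : AddCircle (2 * Real.pi))).re| := by
        rw [h4]; simp
    _ ≤ ‖(F (θ : AddCircle (2 * Real.pi))) - G (θ : AddCircle (2 * Real.pi))‖ := abs_re_le_norm _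
    _ ≤ ε := by rw [← dist_eq_norm]; exact h5.le

/-- Poisson modification of `v` in the disc of centre `c` and radius `R`. -/
noncomputable def modif (c : ℂ) (R : ℝ) (v : ℂ → ℝ) (w : ℂ) : ℝ :=
  open Classical in if w ∈ ball c R then poisson c R v w else v w

theorem modif_in {c : ℂ} {R : ℝ} {v : ℂ → ℝ} {w : ℂ} (h : w ∈ ball c R) :
    modif c R v w = poisson c R v w := if_pos h
theorem modif_out {c : ℂ} {R : ℝ} {v : ℂ → ℝ} {w : ℂ} (h : w ∉ ball c R) :
    modif c R v w = v w := if_neg h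

theorem modif_continuousOn_closedBall {f : ℂ → ℝ} {c : ℂ} {R : ℝ} (hR : 0 < R)
    (hf : ContinuousOn f (sphere c R)) : ContinuousOn (modif c R f) (closedBall c R) := by
  refine continuousOn_of_uniform_approx_of_continuousOn fun u hu => ?_
  obtain ⟨ε, hε, hεu⟩ := Metric.mem_uniformity_dist.1 hu
  obtain ⟨q, hq, h⟩ := exists_harmonic_approx hR hf (half_pos hε)
  refine ⟨q, hq.continuousOn_ball, fun w hw => hεu (lt_of_le_of_lt ?_ (half_lt_self hε))⟩
  rw [Real.dist_eq]
  by_cases hwb : w ∈ ball c R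
  · rw [modif_in hwb]
    have hfi : CircleIntegrable f c R := hf.circleIntegrable hR.le
    have hqs : ContinuousOn q (sphere c R) := hq.continuousOn_ball.mono sphere_subset_closedBall
    have hqi : CircleIntegrable q c R := hqs.circleIntegrable hR.le
    have hci : CircleIntegrable (fun _ : ℂ => ε / 2) c R := circleIntegrable_const _ _ _
    have e1 : poisson c R q w = q w := HarmonicContOnCl.circleAverage_poissonKernel_smul hq hwb
    have e2 := poisson_mono hwb hfi (hqi.add hci)
      (fun z hz => by have := (abs_le.1 (h z hz)).2; simp only [Pi.add_apply]; linarith)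
    have e3 := poisson_mono hwb hqi (hfi.add hci)
      (fun z hz => by have := (abs_le.1 (h z hz)).1; simp only [Pi.add_apply]; linarith)
    rw [poisson_add hwb hqi hci, poisson_const hwb, e1] at e2
    rw [poisson_add hwb hfi hci, poisson_const hwb, e1] at e3
    rw [abs_le]; constructor <;> linarith
  · rw [modif_out hwb]
    exact h w (by simp only [mem_ball, not_lt, mem_closedBall] at hw hwb; exact le_antisymm hw hwb)

end Potential

namespace Potential
open Complex Metric Set Filter Topology InnerProductSpace Real

theorem poisson_tendsto {v : ℕ → ℂ → ℝ} {h b : ℂ → ℝ} {c : ℂ} {R : ℝ} (hR : 0 < R)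
    (hv : ∀ n, ContinuousOn (v n) (sphere c R)) (hb : ContinuousOn b (sphere c R))
    (hvb : ∀ n, ∀ z ∈ sphere c R, |v n z| ≤ b z)
    (hlim : ∀ z ∈ sphere c R, Tendsto (fun n => v n z) atTop (𝓝 (h z))) :
    CircleIntegrable h c R ∧ ∀ w ∈ ball c R,
      Tendsto (fun n => poisson c R (v n) w) atTop (𝓝 (poisson c R h w)) := by
  have hm : ∀ θ, circleMap c R θ ∈ sphere c R := circleMap_mem_sphere c hR.le
  have hvc : ∀ n, Continuous fun θ => v n (circleMap c R θ) := fun n =>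
    (hv n).comp_continuous (continuous_circleMap c R) hm
  have hbc : Continuous fun θ => b (circleMap c R θ) :=
    hb.comp_continuous (continuous_circleMap c R) hm
  have hmeas : Measurable fun θ => h (circleMap c R θ) :=
    measurable_of_tendsto_metrizable (fun n => (hvc n).measurable)
      (tendsto_pi_nhds.2 fun θ => hlim _ (hm θ))
  have hhb : ∀ z ∈ sphere c R, |h z| ≤ b z := fun z hz =>
    le_of_tendsto (hlim z hz).abs (Eventually.of_forall fun n => hvb n z hz)
  have hint : CircleIntegrable h c R := by
    refine IntervalIntegrable.mono_fun (hbc.intervalIntegrable 0 (2 * Real.pi))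
      hmeas.aestronglyMeasurable (Eventually.of_forall fun θ => ?_)
    simp only [Real.norm_eq_abs]
    exact (hhb _ (hm θ)).trans (le_abs_self _)
  refine ⟨hint, fun w hw => ?_⟩
  have hk : Continuous fun θ => poissonKernel c w (circleMap c R θ) := by
    rw [poissonKernel_eq_re_herglotzRieszKernel]
    refine continuous_re.comp ((continuousOn_herglotzRieszKernel_sphere hw).comp_continuous
      (continuous_circleMap c R) fun θ => ?_)
    rw [abs_of_pos hR]; exact hm θ
  unfold poisson circleAverage
  refine Tendsto.const_smul ?_ _
  refine intervalIntegral.tendsto_integral_filter_of_dominated_convergence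
    (fun θ => poissonKernel c w (circleMap c R θ) * b (circleMap c R θ))
    (Eventually.of_forall fun n => ?_) (Eventually.of_forall fun n => ?_)
    ((hk.mul hbc).intervalIntegrable _ _) (Eventually.of_forall fun θ _ => ?_)
  · exact (hk.mul (hvc n)).aestronglyMeasurable
  · refine Eventually.of_forall fun θ _ => ?_
    have h0 := poissonKernel_nonneg (hm θ) hw
    simp only [Pi.smul_apply', smul_eq_mul, Real.norm_eq_abs, abs_mul, abs_of_nonneg h0]
    exact mul_le_mul_of_nonneg_left (hvb n _ (hm θ)) h0
  · exact (hlim _ (hm θ)).const_mul _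

/-- The sub-mean value property on all sufficiently small circles about points of `S`. -/
def SubMean (v : ℂ → ℝ) (S : Set ℂ) : Prop :=
  ∀ z ∈ S, ∀ᶠ r in 𝓝[>] (0 : ℝ), v z ≤ Real.circleAverage v z r

theorem eventually_closedBall {S : Set ℂ} (hS : IsOpen S) {z : ℂ} (hz : z ∈ S) :
    ∀ᶠ r in 𝓝[>] (0 : ℝ), 0 < r ∧ closedBall z r ⊆ S := by
  obtain ⟨ε, hε, h⟩ := Metric.isOpen_iff.1 hS z hz
  filter_upwards [Ioo_mem_nhdsGT hε] with r hr
  exact ⟨hr.1, (closedBall_subset_ball hr.2).trans h⟩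

theorem circleIntegrable_of {v : ℂ → ℝ} {S : Set ℂ} (hv : ContinuousOn v S) {z : ℂ} {r : ℝ}
    (hr : 0 < r) (h : closedBall z r ⊆ S) : CircleIntegrable v z r :=
  (hv.mono (sphere_subset_closedBall.trans h)).circleIntegrable hr.le

theorem max_principle {g : ℂ → ℝ} {c : ℂ} {R : ℝ} (hc : ContinuousOn g (closedBall c R))
    (hs : SubMean g (ball c R)) (hb : ∀ z ∈ sphere c R, g z ≤ 0) :
    ∀ z ∈ closedBall c R, g z ≤ 0 := by
  intro z hz
  by_contra! hpos
  obtain ⟨y, hy, hmax⟩ := (isCompact_closedBall c R).exists_isMaxOn ⟨z, hz⟩ hc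
  have hM : 0 < g y := hpos.trans_le (hmax hz)
  -- among the maximum points choose one farthest from the centre
  have hK : IsCompact (closedBall c R ∩ g ⁻¹' {g y}) :=
    (isCompact_closedBall c R).of_isClosed_subset
      (hc.preimage_isClosed_of_isClosed isClosed_closedBall isClosed_singleton) inter_subset_left
  obtain ⟨x, ⟨hx, hxy⟩, hfar⟩ := hK.exists_isMaxOn ⟨y, hy, rfl⟩
    (f := fun x => dist x c) (by fun_prop)
  have hxy : g x = g y := hxy
  have hxb : x ∈ ball c R := by
    by_contra hx'
    have : x ∈ sphere c R := by
      simp only [mem_ball, not_lt, mem_closedBall, mem_sphere] at *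
      exact le_antisymm hx hx'
    have := hb x this
    linarith
  obtain ⟨r, ⟨hr, hrb⟩, hav⟩ := ((eventually_closedBall isOpen_ball hxb).and (hs x hxb)).exists
  have hrb' : closedBall x r ⊆ closedBall c R := hrb.trans ball_subset_closedBall
  have hm : ∀ θ, circleMap x r θ ∈ closedBall x r := fun θ =>
    sphere_subset_closedBall (circleMap_mem_sphere x hr.le θ)
  have hgc : Continuous fun θ => g (circleMap x r θ) :=
    hc.comp_continuous (continuous_circleMap x r) fun θ => hrb' (hm θ)
  -- a point of the small circle farther from the centre
  obtain ⟨y', hy's, hy'd⟩ : ∃ y' ∈ sphere x r, dist x c < dist y' c := by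
    by_cases hxc : x = c
    · refine ⟨x + r, by simp [abs_of_pos hr], ?_⟩
      subst hxc; simp [dist_eq_norm, hr.ne']
    · have hn : 0 < ‖x - c‖ := norm_pos_iff.2 (sub_ne_zero.2 hxc)
      refine ⟨x + (r / ‖x - c‖ : ℝ) • (x - c), ?_, ?_⟩
      · simp [abs_of_pos hr, hn.ne']
      · have : x + (r / ‖x - c‖ : ℝ) • (x - c) - c = (1 + r / ‖x - c‖ : ℝ) • (x - c) := by
          rw [add_smul, one_smul]; ring
        have h1 : 0 < r / ‖x - c‖ := by positivity
        rw [dist_eq_norm, dist_eq_norm, this, norm_smul, Real.norm_eq_abs, abs_of_pos (by linarith)]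
        nlinarith
  have hy'lt : g y' < g y := by
    refine lt_of_le_of_ne (hmax (hrb' (sphere_subset_closedBall hy's))) fun h => ?_
    have : dist y' c ≤ dist x c := hfar ⟨hrb' (sphere_subset_closedBall hy's), h⟩
    linarith
  rw [← abs_of_pos hr, ← image_circleMap_Ioc] at hy's
  obtain ⟨θ, hθ, hθy⟩ := hy's
  have hlt : (∫ θ in 0..2 * Real.pi, g (circleMap x r θ)) < ∫ _ in 0..2 * Real.pi, g y :=
    intervalIntegral.integral_lt_integral_of_continuousOn_of_le_of_exists_lt Real.two_pi_pos
      hgc.continuousOn continuousOn_const (fun θ _ => hmax (hrb' (hm θ)))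
      ⟨θ, Ioc_subset_Icc_self hθ, by rwa [hθy]⟩
  rw [circleAverage_def, smul_eq_mul, hxy] at hav
  rw [intervalIntegral.integral_const, sub_zero, smul_eq_mul] at hlt
  have h2 := mul_lt_mul_of_pos_left hlt (inv_pos.2 Real.two_pi_pos)
  rw [inv_mul_cancel_left₀ Real.two_pi_pos.ne'] at h2
  linarith

theorem SubMean.add {u v : ℂ → ℝ} {S : Set ℂ} (hS : IsOpen S) (hu : SubMean u S) (hv : SubMean v S)
    (hu' : ContinuousOn u S) (hv' : ContinuousOn v S) : SubMean (u + v) S := by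
  intro z hz
  filter_upwards [hu z hz, hv z hz, eventually_closedBall hS hz] with r h1 h2 h3
  rw [circleAverage_add (circleIntegrable_of hu' h3.1 h3.2) (circleIntegrable_of hv' h3.1 h3.2)]
  exact add_le_add h1 h2

theorem SubMean.congr {u v : ℂ → ℝ} {S : Set ℂ} (hS : IsOpen S) (hu : SubMean u S)
    (h : EqOn u v S) : SubMean v S := by
  intro z hz
  filter_upwards [hu z hz, eventually_closedBall hS hz] with r h1 h2
  rw [← h hz]
  refine h1.trans (le_of_eq (circleAverage_congr_sphere fun x hx => h (h2.2 ?_)))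
  rw [abs_of_pos h2.1] at hx
  exact sphere_subset_closedBall hx

theorem SubMean.of_harmonic {u : ℂ → ℝ} {S : Set ℂ} (hS : IsOpen S) (hu : HarmonicOnNhd u S) :
    SubMean u S := by
  intro z hz
  filter_upwards [eventually_closedBall hS hz] with r h
  refine le_of_eq (InnerProductSpace.HarmonicOnNhd.circleAverage_eq (hu.mono ?_)).symm
  rw [abs_of_pos h.1]; exact h.2

theorem modif_sub {Ω : Set ℂ} (hΩ : IsOpen Ω) {c : ℂ} {R : ℝ} (hR : 0 < R)
    (hB : closedBall c R ⊆ Ω) {v : ℂ → ℝ} (hvc : ContinuousOn v Ω) (hv : SubMean v Ω) :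
    ContinuousOn (modif c R v) Ω ∧ SubMean (modif c R v) Ω ∧ (∀ z ∈ Ω, v z ≤ modif c R v z) ∧
      ∀ w : ℂ → ℝ, ContinuousOn w Ω → SubMean (-w) Ω → (∀ z ∈ Ω, v z ≤ w z) →
        ∀ z ∈ Ω, modif c R v z ≤ w z := by
  have hsph : sphere c R ⊆ Ω := sphere_subset_closedBall.trans hB
  have hball : ball c R ⊆ Ω := ball_subset_closedBall.trans hB
  have hcb := modif_continuousOn_closedBall hR (hvc.mono hsph)
  have hvi : CircleIntegrable v c R := circleIntegrable_of hvc hR hB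
  have hout : EqOn (modif c R v) v (ball c R)ᶜ := fun z hz => modif_out hz
  have hsout : ∀ z ∈ sphere c R, modif c R v z = v z := fun z hz => modif_out (by
    simp only [mem_sphere, mem_ball, not_lt] at *; exact hz.ge)
  have hharm : HarmonicOnNhd (modif c R v) (ball c R) := fun z hz =>
    (harmonicAt_congr_nhds (by
      filter_upwards [isOpen_ball.mem_nhds hz] with x hx using modif_in hx)).2
      (poisson_harmonic hvi z hz)
  have hcont : ContinuousOn (modif c R v) Ω := by
    have h2 : ContinuousOn (modif c R v) (Ω ∩ (ball c R)ᶜ) :=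
      (hvc.mono inter_subset_left).congr (hout.mono inter_subset_right)
    intro z hz
    have h1 : ContinuousWithinAt (modif c R v) (closedBall c R) z := by
      by_cases hz' : z ∈ closedBall c R
      · exact hcb z hz'
      · exact continuousWithinAt_of_notMem_closure (by rwa [isClosed_closedBall.closure_eq])
    have h3 : ContinuousWithinAt (modif c R v) (Ω ∩ (ball c R)ᶜ) z := by
      by_cases hz' : z ∈ ball c R
      · refine continuousWithinAt_of_notMem_closure fun hmem => ?_
        have := closure_mono (inter_subset_right (s := Ω)) hmem
        rw [isOpen_ball.isClosed_compl.closure_eq] at this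
        exact this hz'
      · exact h2 z ⟨hz, hz'⟩
    refine (h1.union h3).mono fun x hx => ?_
    by_cases hx' : x ∈ ball c R
    · exact Or.inl (ball_subset_closedBall hx')
    · exact Or.inr ⟨hx, hx'⟩
  have hle : ∀ z ∈ Ω, v z ≤ modif c R v z := by
    intro z hz
    by_cases hz' : z ∈ ball c R
    · have hneg : SubMean (-modif c R v) (ball c R) := SubMean.of_harmonic isOpen_ball hharm.neg
      have h1 := SubMean.add isOpen_ball (fun x hx => hv x (hball hx)) hneg (hvc.mono hball)
        (hharm.continuousOn.neg)
      have := max_principle ((hvc.mono hB).add hcb.neg) h1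
        (fun x hx => by simp [hsout x hx]) z (ball_subset_closedBall hz')
      simp only [Pi.add_apply, Pi.neg_apply] at this
      linarith
    · rw [modif_out hz']
  refine ⟨hcont, ?_, hle, ?_⟩
  · intro z hz
    by_cases hz' : z ∈ ball c R
    · exact SubMean.of_harmonic isOpen_ball hharm z hz'
    · filter_upwards [hv z hz, eventually_closedBall hΩ hz] with r h1 h2
      rw [modif_out hz']
      refine h1.trans (circleAverage_mono (circleIntegrable_of hvc h2.1 h2.2)
        (circleIntegrable_of hcont h2.1 h2.2) fun x hx => hle x (h2.2 ?_))
      rw [abs_of_pos h2.1] at hx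
      exact sphere_subset_closedBall hx
  · intro w hwc hw hvw z hz
    by_cases hz' : z ∈ ball c R
    · have h1 := SubMean.add isOpen_ball (SubMean.of_harmonic isOpen_ball hharm)
        (fun x hx => hw x (hball hx)) hharm.continuousOn ((hwc.mono hball).neg)
      have := max_principle (hcb.add (hwc.mono hB).neg) h1
        (fun x hx => by
          have := hvw x (hsph hx)
          simp only [Pi.add_apply, Pi.neg_apply, hsout x hx]; linarith) z
          (ball_subset_closedBall hz')
      simp only [Pi.add_apply, Pi.neg_apply] at this
      linarith
    · rw [modif_out hz']; exact hvw z hz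

/-- A harmonic function can be put between a subharmonic and a superharmonic one. -/
theorem exists_harmonic_between {Ω : Set ℂ} (hΩ : IsOpen Ω) {s w : ℂ → ℝ}
    (hsc : ContinuousOn s Ω) (hs : SubMean s Ω) (hwc : ContinuousOn w Ω) (hw : SubMean (-w) Ω)
    (hsw : ∀ z ∈ Ω, s z ≤ w z) :
    ∃ h : ℂ → ℝ, HarmonicOnNhd h Ω ∧ ∀ z ∈ Ω, s z ≤ h z ∧ h z ≤ w z := by
  rcases Ω.eq_empty_or_nonempty with rfl | hne
  · exact ⟨0, fun z hz => hz.elim, fun z hz => hz.elim⟩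
  -- countably many discs covering `Ω`, each visited infinitely often
  have hex : ∀ z : ℂ, ∃ r : ℝ, z ∈ Ω → 0 < r ∧ closedBall z r ⊆ Ω := fun z => by
    by_cases hz : z ∈ Ω
    · obtain ⟨r, hr⟩ := (eventually_closedBall hΩ hz).exists
      exact ⟨r, fun _ => hr⟩
    · exact ⟨0, fun h => (hz h).elim⟩
  choose r hr using hex
  obtain ⟨T, hTΩ, hTc, hT⟩ := TopologicalSpace.countable_cover_nhdsWithin (s := Ω)
    (f := fun z => ball z (r z))
    (fun z hz => mem_nhdsWithin_of_mem_nhds (ball_mem_nhds z (hr z hz).1))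
  have hTne : T.Nonempty := by
    obtain ⟨z, hz⟩ := hne
    obtain ⟨i, hi, _⟩ := mem_iUnion₂.1 (hT hz)
    exact ⟨i, hi⟩
  obtain ⟨e, he⟩ := hTc.exists_eq_range hTne
  have heΩ : ∀ n, e n ∈ Ω := fun n => hTΩ (he ▸ mem_range_self n)
  let v : ℕ → ℂ → ℝ := fun n => Nat.rec s
    (fun k u => modif (e k.unpair.1) (r (e k.unpair.1)) u) n
  have hvs : ∀ n, v (n + 1) = modif (e n.unpair.1) (r (e n.unpair.1)) (v n) := fun n => rfl
  have hv : ∀ n, ContinuousOn (v n) Ω ∧ SubMean (v n) Ω ∧ ∀ z ∈ Ω, v n z ≤ w z := by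
    intro n
    induction n with
    | zero => exact ⟨hsc, hs, hsw⟩
    | succ n ih =>
      have h := modif_sub hΩ (hr _ (heΩ n.unpair.1)).1 (hr _ (heΩ n.unpair.1)).2 ih.1 ih.2.1
      rw [hvs]
      exact ⟨h.1, h.2.1, h.2.2.2 w hwc hw ih.2.2⟩
  have hmono : ∀ z ∈ Ω, Monotone fun n => v n z := fun z hz => monotone_nat_of_le_succ fun n => by
    rw [hvs]
    exact (modif_sub hΩ (hr _ (heΩ n.unpair.1)).1 (hr _ (heΩ n.unpair.1)).2
      (hv n).1 (hv n).2.1).2.2.1 z hz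
  have hbdd : ∀ z ∈ Ω, BddAbove (range fun n => v n z) := fun z hz =>
    ⟨w z, by rintro _ ⟨n, rfl⟩; exact (hv n).2.2 z hz⟩
  set h : ℂ → ℝ := fun z => ⨆ n, v n z with hh
  have hlim : ∀ z ∈ Ω, Tendsto (fun n => v n z) atTop (𝓝 (h z)) := fun z hz =>
    tendsto_atTop_ciSup (hmono z hz) (hbdd z hz)
  have hsv : ∀ n, ∀ z ∈ Ω, s z ≤ v n z := fun n z hz => hmono z hz (Nat.zero_le n)
  refine ⟨h, fun z hz => ?_, fun z hz => ⟨le_ciSup (hbdd z hz) 0, ciSup_le fun n => (hv n).2.2 z hz⟩⟩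
  obtain ⟨i, hi, hzi⟩ := mem_iUnion₂.1 (hT hz)
  obtain ⟨k, rfl⟩ : ∃ k, e k = i := by rw [he] at hi; exact hi
  have hB := (hr _ (heΩ k)).2
  have hsph := sphere_subset_closedBall.trans hB
  have hR := (hr _ (heΩ k)).1
  have hsub : Tendsto (fun j => Nat.pair k j) atTop atTop :=
    tendsto_atTop_mono (fun j => Nat.right_le_pair k j) tendsto_id
  have hP := poisson_tendsto (v := fun j => v (Nat.pair k j)) (h := h)
    (b := fun z => |s z| + |w z|) hR (fun j => (hv _).1.mono hsph)
    ((hsc.mono hsph).abs.add (hwc.mono hsph).abs)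
    (fun j x hx => by
      have h1 := hsv (Nat.pair k j) x (hsph hx)
      have h2 := (hv (Nat.pair k j)).2.2 x (hsph hx)
      rw [abs_le]
      constructor
      · linarith [neg_abs_le (s x), abs_nonneg (w x)]
      · linarith [le_abs_self (w x), abs_nonneg (s x)])
    (fun x hx => (hlim x (hsph hx)).comp hsub)
  refine (harmonicAt_congr_nhds ?_).2 (poisson_harmonic hP.1 z hzi)
  filter_upwards [isOpen_ball.mem_nhds hzi] with x hx
  refine tendsto_nhds_unique (((hlim x (hB (ball_subset_closedBall hx))).comp
    (tendsto_add_atTop_nat 1)).comp hsub) ((hP.2 x hx).congr fun j => ?_)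
  simp only [Function.comp_apply, hvs, Nat.unpair_pair]
  rw [modif_in hx]

end Potential

namespace Potential
open Complex Metric Set Filter Topology InnerProductSpace Real

theorem harnack_disc {u : ℂ → ℝ} {z w : ℂ} {r : ℝ} (hr : 0 < r)
    (hu : HarmonicOnNhd u (closedBall z (2 * r))) (h0 : ∀ x ∈ closedBall z (2 * r), 0 ≤ u x)
    (hw : w ∈ closedBall z r) : u w ≤ 3 * u z ∧ u z ≤ 3 * u w := by
  have h2r : (0 : ℝ) < 2 * r := by positivity
  have hwb : w ∈ ball z (2 * r) := closedBall_subset_ball (by linarith) hw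
  have hP := HarmonicOnNhd.circleAverage_poissonKernel_smul hu hwb
  have hM : circleAverage u z (2 * r) = u z :=
    InnerProductSpace.HarmonicOnNhd.circleAverage_eq (by rwa [abs_of_pos h2r])
  have hui : CircleIntegrable u z (2 * r) := circleIntegrable_of hu.continuousOn h2r subset_rfl
  have hPi := poissonKernel_integrable hwb hui
  have hd : ‖w - z‖ ≤ r := by simpa [dist_eq_norm] using hw
  have hd0 := norm_nonneg (w - z)
  have e : ∀ x, poissonKernel z w x = ((x - z + (w - z)) / ((x - z) - (w - z))).re := fun x => by
    rw [poissonKernel_eq_re_herglotzRieszKernel]; rfl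
  constructor
  · rw [← hP, ← hM, ← smul_eq_mul (3 : ℝ), ← circleAverage_smul]
    refine circleAverage_mono hPi (hui.const_smul (a := (3 : ℝ))) fun x hx => ?_
    rw [abs_of_pos h2r] at hx
    simp only [Pi.smul_apply', Pi.smul_apply, smul_eq_mul]
    refine mul_le_mul_of_nonneg_right ?_ (h0 x (sphere_subset_closedBall hx))
    rw [e]
    refine (re_herglotzRieszKernel_le hx hwb).trans ?_
    rw [div_le_iff₀ (by linarith)]; linarith
  · have : (1 / 3 : ℝ) * u z ≤ u w := by
      rw [← hP, ← hM, ← smul_eq_mul (1 / 3 : ℝ), ← circleAverage_smul]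
      refine circleAverage_mono (hui.const_smul (a := (1 / 3 : ℝ))) hPi fun x hx => ?_
      rw [abs_of_pos h2r] at hx
      simp only [Pi.smul_apply', Pi.smul_apply, smul_eq_mul]
      refine mul_le_mul_of_nonneg_right ?_ (h0 x (sphere_subset_closedBall hx))
      rw [e]
      refine le_trans ?_ (le_re_herglotzRieszKernel hx hwb)
      rw [le_div_iff₀ (by linarith)]; linarith
    linarith

theorem harnack {Ω : Set ℂ} (hΩ : IsOpen Ω) (hc : IsPreconnected Ω) {t : ℂ} (ht : t ∈ Ω)
    {z : ℂ} (hz : z ∈ Ω) : ∃ C > 0, ∃ r > 0, closedBall z r ⊆ Ω ∧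
      ∀ u : ℂ → ℝ, HarmonicOnNhd u Ω → (∀ x ∈ Ω, 0 ≤ u x) →
        ∀ w ∈ closedBall z r, u w ≤ C * u t := by
  set S : Set ℂ := {z | z ∈ Ω ∧ ∃ C > 0, ∀ u : ℂ → ℝ, HarmonicOnNhd u Ω → (∀ x ∈ Ω, 0 ≤ u x) →
    u z ≤ C * u t} with hS
  have key : ∀ z ∈ Ω, ∃ r > 0, closedBall z (2 * r) ⊆ Ω := fun z hz => by
    obtain ⟨ρ, hρ, h⟩ := (eventually_closedBall hΩ hz).exists
    exact ⟨ρ / 2, by positivity, by rwa [mul_div_cancel₀ _ (two_ne_zero)]⟩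
  have step : ∀ z ∈ S, ∃ C > 0, ∃ r > 0, closedBall z r ⊆ Ω ∧
      ∀ u : ℂ → ℝ, HarmonicOnNhd u Ω → (∀ x ∈ Ω, 0 ≤ u x) →
        ∀ w ∈ closedBall z r, u w ≤ C * u t := by
    rintro z ⟨hz, C, hC, h⟩
    obtain ⟨r, hr, hrΩ⟩ := key z hz
    refine ⟨3 * C, by positivity, r, hr,
      (closedBall_subset_closedBall (by linarith)).trans hrΩ, fun u hu hu0 w hw => ?_⟩
    have h1 := (harnack_disc hr (hu.mono hrΩ) (fun x hx => hu0 x (hrΩ hx)) hw).1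
    have h2 := h u hu hu0
    linarith
  refine step z (hc.subset_of_closure_inter_subset (u := S) ?_ ⟨t, ht, ht, 1, one_pos, by simp⟩ ?_ hz)
  · refine Metric.isOpen_iff.2 fun z hz => ?_
    obtain ⟨C, hC, r, hr, hrΩ, h⟩ := step z hz
    exact ⟨r, hr, fun w hw => ⟨hrΩ (ball_subset_closedBall hw), C, hC,
      fun u hu hu0 => h u hu hu0 w (ball_subset_closedBall hw)⟩⟩
  · rintro z ⟨hzS, hz⟩
    obtain ⟨r, hr, hrΩ⟩ := key z hz
    obtain ⟨w, ⟨hw, C, hC, h⟩, hwz⟩ := Metric.mem_closure_iff.1 hzS r hr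
    refine ⟨hz, 3 * C, by positivity, fun u hu hu0 => ?_⟩
    have h1 := (harnack_disc hr (hu.mono hrΩ) (fun x hx => hu0 x (hrΩ hx))
      (w := w) (by rw [mem_closedBall, dist_comm]; exact hwz.le)).2
    have h2 := h u hu hu0
    linarith

theorem harmonic_tsum {Ω : Set ℂ} (hΩ : IsOpen Ω) (hc : IsPreconnected Ω) {t : ℂ} (ht : t ∈ Ω)
    {u : ℕ → ℂ → ℝ} (hu : ∀ k, HarmonicOnNhd (u k) Ω) (h0 : ∀ k, ∀ x ∈ Ω, 0 ≤ u k x)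
    (hs : Summable fun k => u k t) :
    (∀ z ∈ Ω, Summable fun k => u k z) ∧ HarmonicOnNhd (fun z => ∑' k, u k z) Ω := by
  have hsum : ∀ z ∈ Ω, Summable fun k => u k z := fun z hz => by
    obtain ⟨C, hC, r, hr, hrΩ, h⟩ := harnack hΩ hc ht hz
    exact Summable.of_nonneg_of_le (fun k => h0 k z hz)
      (fun k => h (u k) (hu k) (h0 k) z (mem_closedBall_self hr.le)) (hs.mul_left C)
  refine ⟨hsum, fun z hz => ?_⟩
  obtain ⟨C, hC, r, hr, hrΩ, h⟩ := harnack hΩ hc ht hz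
  set v : ℕ → ℂ → ℝ := fun n x => ∑ k ∈ Finset.range n, u k x with hv
  have hvh : ∀ n, HarmonicOnNhd (v n) Ω := by
    intro n
    induction n with
    | zero => simp [hv]
    | succ n ih =>
      have : v (n + 1) = v n + u n := by ext x; simp [hv, Finset.sum_range_succ]
      rw [this]; exact ih.add (hu n)
  have hlim : ∀ x ∈ Ω, Tendsto (fun n => v n x) atTop (𝓝 (∑' k, u k x)) := fun x hx =>
    (hsum x hx).hasSum.tendsto_sum_nat
  have hP := poisson_tendsto (v := v) (h := fun x => ∑' k, u k x) (c := z)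
    (b := fun _ => C * ∑' k, u k t) hr
    (fun n => (hvh n).continuousOn.mono (sphere_subset_closedBall.trans hrΩ)) continuousOn_const
    (fun n x hx => by
      have hx' := sphere_subset_closedBall hx
      rw [abs_of_nonneg (Finset.sum_nonneg fun k _ => h0 k x (hrΩ hx')), ← tsum_mul_left]
      refine (Finset.sum_le_sum fun k _ => h (u k) (hu k) (h0 k) x hx').trans ?_
      exact (hs.mul_left C).sum_le_tsum _ fun k _ => mul_nonneg hC.le (h0 k t ht))
    (fun x hx => hlim x (hrΩ (sphere_subset_closedBall hx)))
  refine (harmonicAt_congr_nhds ?_).2 (poisson_harmonic hP.1 z (mem_ball_self hr))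
  filter_upwards [isOpen_ball.mem_nhds (mem_ball_self hr)] with x hx
  refine tendsto_nhds_unique (hlim x (hrΩ (ball_subset_closedBall hx)))
    ((hP.2 x hx).congr fun n => ?_)
  exact HarmonicOnNhd.circleAverage_poissonKernel_smul ((hvh n).mono hrΩ) hx

end Potential

/- Part 2. The domain, modulus automorphic functions and the Hardy space `H²_α(Ω)`. -/

/-- A simple closed analytic curve, parametrised with period `1`. -/
structure IsSimpleClosedAnalyticCurve (γ : ℝ → ℂ) : Prop where
  analytic : ∀ s, AnalyticAt ℝ γ s
  deriv_ne_zero : ∀ s, deriv γ s ≠ 0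
  periodic : Function.Periodic γ 1
  injOn : Set.InjOn γ (Set.Ico 0 1)

/-- A bounded, finitely connected planar domain whose boundary is the disjoint union of finitely
many simple closed analytic curves and whose complement has exactly `m` bounded components. The
points `hole j` are one (arbitrary) marked point in each bounded component of the complement. -/
structure PlanarDomain (m : ℕ) where
  carrier : Set ℂ
  isOpen : IsOpen carrier
  isConnected : IsConnected carrier
  isBounded : Bornology.IsBounded carrier
  boundary : ∃ (k : ℕ) (γ : Fin k → ℝ → ℂ), (∀ i, IsSimpleClosedAnalyticCurve (γ i)) ∧
    (∀ i j, i ≠ j → Disjoint (Set.range (γ i)) (Set.range (γ j))) ∧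
    frontier carrier = ⋃ i, Set.range (γ i)
  hole : Fin m → ℂ
  hole_notMem : ∀ j, hole j ∉ carrier
  hole_bounded : ∀ j, Bornology.IsBounded (connectedComponentIn carrierᶜ (hole j))
  hole_injective : Function.Injective fun j => connectedComponentIn carrierᶜ (hole j)
  hole_exhaust : ∀ q, q ∉ carrier → Bornology.IsBounded (connectedComponentIn carrierᶜ q) →
    ∃ j, q ∈ connectedComponentIn carrierᶜ (hole j)

namespace PlanarDomain

variable {m : ℕ} (Ω : PlanarDomain m)

/-- The (maximal abelian) covering surface of `Ω` on which all multivalued functions with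
unimodular multipliers become single-valued: a point over `z ∈ Ω` is `z` together with a choice of
a value of each `log (z - hole j)`. Going once around the `j`-th hole in the positive direction
adds `2πi` to the `j`-th logarithm and does not change the other ones. -/
def Cover : Type :=
  {x : ℂ × (Fin m → ℂ) // x.1 ∈ Ω.carrier ∧ ∀ j, Complex.exp (x.2 j) = x.1 - Ω.hole j}

noncomputable instance : TopologicalSpace Ω.Cover := instTopologicalSpaceSubtype

variable {Ω}

/-- The point of `Ω` under a point of the covering surface. -/
def Cover.pt (x : Ω.Cover) : ℂ := x.1.1

theorem Cover.pt_mem (x : Ω.Cover) : x.pt ∈ Ω.carrier := x.2.1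

/-- The deck transformation which corresponds to going `n j` times around the `j`-th hole. -/
noncomputable def Cover.shift (x : Ω.Cover) (n : Fin m → ℤ) : Ω.Cover :=
  ⟨(x.1.1, fun j => x.1.2 j + n j * (2 * Real.pi * Complex.I)), x.2.1, fun j => by
    rw [Complex.exp_add, Complex.exp_int_mul_two_pi_mul_I, mul_one, x.2.2 j]⟩

/-- `F` is a modulus automorphic (multivalued) holomorphic function on `Ω` of index `α ∈ 𝕋^m`:
every continuous branch of `F` is holomorphic, and the continuation of `F` along a loop that winds
`n j` times around the `j`-th hole multiplies it by `∏ j, (α j) ^ (n j)`. -/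
structure IsModulusAutomorphic (α : Fin m → Circle) (F : Ω.Cover → ℂ) : Prop where
  holomorphic : ∀ (U : Set ℂ) (s : ℂ → Ω.Cover), IsOpen U → ContinuousOn s U →
    (∀ z ∈ U, (s z).pt = z) → DifferentiableOn ℂ (fun z => F (s z)) U
  automorphy : ∀ (x : Ω.Cover) (n : Fin m → ℤ), F (x.shift n) = (∏ j, (α j : ℂ) ^ n j) * F x

/-- `u` is a harmonic function on `Ω` with `|F|² ≤ u`. -/
structure IsHarmonicMajorant (F : Ω.Cover → ℂ) (u : ℂ → ℝ) : Prop where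
  harmonic : InnerProductSpace.HarmonicOnNhd u Ω.carrier
  le : ∀ x : Ω.Cover, ‖F x‖ ^ 2 ≤ u x.pt

theorem exists_section (x : Ω.Cover) : ∃ r > 0, Metric.ball x.pt r ⊆ Ω.carrier ∧
    ∃ s : ℂ → Ω.Cover, ContinuousOn s (Metric.ball x.pt r) ∧
      (∀ z ∈ Metric.ball x.pt r, (s z).pt = z) ∧ s x.pt = x := by
  obtain ⟨r, hr, hrΩ⟩ := Metric.isOpen_iff.1 Ω.isOpen x.pt x.pt_mem
  have hne : ∀ j, x.pt - Ω.hole j ≠ 0 := fun j h =>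
    Ω.hole_notMem j (by rw [← sub_eq_zero.1 h]; exact x.pt_mem)
  have hslit : ∀ j, ∀ z ∈ Metric.ball x.pt r,
      1 + (z - x.pt) / (x.pt - Ω.hole j) ∈ Complex.slitPlane := fun j z hz => by
    apply Complex.mem_slitPlane_of_norm_lt_one
    have h1 : ‖z - x.pt‖ < r := by simpa [dist_eq_norm] using hz
    have h2 : r ≤ ‖x.pt - Ω.hole j‖ := by
      by_contra! h
      exact Ω.hole_notMem j (hrΩ (by rwa [Metric.mem_ball, dist_comm, dist_eq_norm]))
    rw [norm_div, div_lt_one (by linarith)]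
    linarith
  classical
  let ℓ : ℂ → Fin m → ℂ := fun z j => x.1.2 j + Complex.log (1 + (z - x.pt) / (x.pt - Ω.hole j))
  have hℓ : ∀ z ∈ Metric.ball x.pt r, z ∈ Ω.carrier ∧
      ∀ j, Complex.exp (ℓ z j) = z - Ω.hole j := fun z hz => ⟨hrΩ hz, fun j => by
    have e : Complex.exp (x.1.2 j) = x.pt - Ω.hole j := x.2.2 j
    have := hne j
    rw [Complex.exp_add, Complex.exp_log (Complex.slitPlane_ne_zero (hslit j z hz)), e]
    field_simp
    ring⟩
  let s : ℂ → Ω.Cover := fun z => if h : z ∈ Metric.ball x.pt r then ⟨(z, ℓ z), hℓ z h⟩ else x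
  have hs1 : ∀ z (h : z ∈ Metric.ball x.pt r), s z = ⟨(z, ℓ z), hℓ z h⟩ := fun z h => dif_pos h
  refine ⟨r, hr, hrΩ, s, ?_, fun z hz => by rw [hs1 z hz]; rfl, ?_⟩
  · refine Topology.IsInducing.subtypeVal.continuousOn_iff.2 ?_
    refine ContinuousOn.congr (f := fun z => (z, ℓ z)) ?_ fun z hz => by
      change (s z).1 = (z, ℓ z)
      rw [hs1 z hz]
    refine continuousOn_id.prodMk (continuousOn_pi.2 fun j => ?_)
    refine continuousOn_const.add (ContinuousOn.clog ?_ (hslit j))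
    fun_prop
  · have : x.pt ∈ Metric.ball x.pt r := Metric.mem_ball_self hr
    rw [hs1 _ this]
    exact Subtype.ext (Prod.ext rfl (funext fun j => by simp [ℓ]))

theorem exists_over {z : ℂ} (hz : z ∈ Ω.carrier) : ∃ x : Ω.Cover, x.pt = z :=
  ⟨⟨(z, fun j => Complex.log (z - Ω.hole j)), hz, fun j => Complex.exp_log fun h =>
    Ω.hole_notMem j (by rw [← sub_eq_zero.1 h]; exact hz)⟩, rfl⟩

theorem exists_shift {x y : Ω.Cover} (h : x.pt = y.pt) : ∃ n, x = y.shift n := by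
  have h' : ∀ j, ∃ n : ℤ, x.1.2 j = y.1.2 j + n * (2 * Real.pi * Complex.I) := fun j => by
    rw [← Complex.exp_eq_exp_iff_exists_int, x.2.2 j, y.2.2 j]
    have : x.1.1 = y.1.1 := h
    rw [this]
  choose n hn using h'
  exact ⟨n, Subtype.ext (Prod.ext h (funext hn))⟩

theorem IsModulusAutomorphic.norm_eq {α : Fin m → Circle} {F : Ω.Cover → ℂ}
    (hF : IsModulusAutomorphic α F) {x y : Ω.Cover} (h : x.pt = y.pt) : ‖F x‖ = ‖F y‖ := by
  obtain ⟨n, rfl⟩ := exists_shift h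
  rw [hF.automorphy, norm_mul, norm_prod]
  have h1 : ∀ j, ‖(α j : ℂ)‖ = 1 := fun j => Circle.norm_coe _
  simp [norm_zpow, h1]

open Classical in
/-- The single-valued function `|F|²` on `Ω`. -/
noncomputable def modSq (F : Ω.Cover → ℂ) (z : ℂ) : ℝ :=
  if hz : z ∈ Ω.carrier then ‖F (exists_over hz).choose‖ ^ 2 else 0

theorem IsModulusAutomorphic.modSq_eq {α : Fin m → Circle} {F : Ω.Cover → ℂ}
    (hF : IsModulusAutomorphic α F) (x : Ω.Cover) : modSq F x.pt = ‖F x‖ ^ 2 := by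
  rw [modSq, dif_pos x.pt_mem, hF.norm_eq (exists_over x.pt_mem).choose_spec]

open Filter Topology in
theorem IsModulusAutomorphic.modSq_sub {α : Fin m → Circle} {F : Ω.Cover → ℂ}
    (hF : IsModulusAutomorphic α F) :
    ContinuousOn (modSq F) Ω.carrier ∧ Potential.SubMean (modSq F) Ω.carrier := by
  have key : ∀ z ∈ Ω.carrier, ∃ r > 0, ∃ f : ℂ → ℂ, DifferentiableOn ℂ f (Metric.ball z r) ∧
      ∀ w ∈ Metric.ball z r, modSq F w = ‖f w‖ ^ 2 := by
    intro z hz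
    obtain ⟨x, rfl⟩ := exists_over hz
    obtain ⟨r, hr, _, s, hs, hsz, _⟩ := exists_section x
    refine ⟨r, hr, fun w => F (s w), hF.holomorphic _ s Metric.isOpen_ball hs hsz, fun w hw => ?_⟩
    rw [← hF.modSq_eq (s w), hsz w hw]
  constructor
  · intro z hz
    obtain ⟨r, hr, f, hf, h⟩ := key z hz
    have hc : ContinuousAt (fun w => ‖f w‖ ^ 2) z :=
      ((hf.continuousOn.continuousAt (Metric.ball_mem_nhds z hr)).norm).pow 2
    refine (hc.congr ?_).continuousWithinAt
    filter_upwards [Metric.ball_mem_nhds z hr] with w hw using (h w hw).symm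
  · intro z hz
    obtain ⟨r, hr, f, hf, h⟩ := key z hz
    filter_upwards [Potential.eventually_closedBall Metric.isOpen_ball (Metric.mem_ball_self hr)]
      with ρ hρ
    have hfρ : DifferentiableOn ℂ (fun w => f w ^ 2) (Metric.closedBall z |ρ|) := by
      rw [abs_of_pos hρ.1]; exact (hf.mono hρ.2).fun_pow 2
    have hm : Real.circleAverage (fun w => f w ^ 2) z ρ = f z ^ 2 :=
      (hfρ.diffContOnCl_ball subset_rfl).circleAverage
    have hcong : Real.circleAverage (modSq F) z ρ
        = Real.circleAverage (fun w => ‖f w ^ 2‖) z ρ :=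
      Real.circleAverage_congr_sphere fun w hw => by
        rw [abs_of_pos hρ.1] at hw
        rw [h w (hρ.2 (Metric.sphere_subset_closedBall hw)), norm_pow]
    rw [hcong, h z (Metric.mem_ball_self hr), ← norm_pow, ← hm, Real.circleAverage,
      Real.circleAverage, norm_smul, Real.norm_of_nonneg (inv_nonneg.2 Real.two_pi_pos.le),
      smul_eq_mul]
    exact mul_le_mul_of_nonneg_left
      (intervalIntegral.norm_integral_le_integral_norm Real.two_pi_pos.le)
      (inv_nonneg.2 Real.two_pi_pos.le)

theorem IsHarmonicMajorant.nonneg {F : Ω.Cover → ℂ} {u : ℂ → ℝ} (hu : IsHarmonicMajorant F u) :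
    ∀ z ∈ Ω.carrier, 0 ≤ u z := fun z hz => by
  obtain ⟨x, rfl⟩ := exists_over hz
  exact (sq_nonneg _).trans (hu.le x)

variable (Ω) in
/-- The vector space of modulus automorphic functions `F` of index `α` on `Ω` for which `|F|²` has
a harmonic majorant. -/
def hardySubmodule (α : Fin m → Circle) : Submodule ℂ (Ω.Cover → ℂ) where
  carrier := {F | IsModulusAutomorphic α F ∧ ∃ u, IsHarmonicMajorant F u}
  zero_mem' := ⟨⟨fun U s _ _ _ => differentiableOn_const 0, fun x n => by simp⟩, 0,
    InnerProductSpace.harmonicOnNhd_const 0, fun x => by simp⟩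
  add_mem' := by
    rintro F G ⟨hF, u, hu⟩ ⟨hG, v, hv⟩
    refine ⟨⟨fun U s hU hs hsz => (hF.holomorphic U s hU hs hsz).add (hG.holomorphic U s hU hs hsz),
      fun x n => by simp [hF.automorphy, hG.automorphy, mul_add]⟩, (2 : ℝ) • (u + v),
      (hu.harmonic.add hv.harmonic).const_smul, fun x => ?_⟩
    have h1 := hu.le x
    have h2 := hv.le x
    have h3 := norm_add_le (F x) (G x)
    have h4 : ‖F x + G x‖ ^ 2 ≤ (‖F x‖ + ‖G x‖) ^ 2 := by gcongr
    simp only [Pi.add_apply, Pi.smul_apply, smul_eq_mul]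
    nlinarith [sq_nonneg (‖F x‖ - ‖G x‖)]
  smul_mem' := by
    rintro c F ⟨hF, u, hu⟩
    refine ⟨⟨fun U s hU hs hsz => (hF.holomorphic U s hU hs hsz).const_smul c,
      fun x n => by simp [hF.automorphy, mul_left_comm]⟩, (‖c‖ ^ 2) • u,
      hu.harmonic.const_smul, fun x => ?_⟩
    simp only [Pi.smul_apply, smul_eq_mul, norm_mul, mul_pow]
    exact mul_le_mul_of_nonneg_left (hu.le x) (sq_nonneg _)

end PlanarDomain

open PlanarDomain in
/-- The Hardy space `H²_α(Ω)`, normed with respect to the base point `t ∈ Ω`. -/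
def HardySpace {m : ℕ} (Ω : PlanarDomain m) (α : Fin m → Circle) (_t : Ω.carrier) : Type :=
  hardySubmodule Ω α

namespace HardySpace

open PlanarDomain

variable {m : ℕ} {Ω : PlanarDomain m} {α : Fin m → Circle} {t : Ω.carrier}

noncomputable instance : AddCommGroup (HardySpace Ω α t) :=
  inferInstanceAs (AddCommGroup (hardySubmodule Ω α))

noncomputable instance : Module ℂ (HardySpace Ω α t) :=
  inferInstanceAs (Module ℂ (hardySubmodule Ω α))

/-- The inclusion of `H²_α(Ω)` into the functions on the covering surface. -/
def toFun : HardySpace Ω α t →ₗ[ℂ] (Ω.Cover → ℂ) := (hardySubmodule Ω α).subtype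

theorem toFun_injective : Function.Injective (toFun : HardySpace Ω α t →ₗ[ℂ] (Ω.Cover → ℂ)) :=
  Subtype.val_injective

theorem auto (F : HardySpace Ω α t) : IsModulusAutomorphic α (toFun F) := F.2.1

theorem exists_majorant (F : HardySpace Ω α t) : ∃ u, IsHarmonicMajorant (toFun F) u := F.2.2

/-- The values at the base point of the harmonic majorants of `|F|²`. -/
def majorantValues (F : HardySpace Ω α t) : Set ℝ :=
  {a | ∃ u, IsHarmonicMajorant (toFun F) u ∧ u t = a}

/-- The norm of `H²_α(Ω)`: `‖F‖²` is the value at the base point of the least harmonic majorant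
of `|F|²`. -/
noncomputable instance : Norm (HardySpace Ω α t) := ⟨fun F => √(sInf (majorantValues F))⟩

theorem majorantValues_nonempty (F : HardySpace Ω α t) : (majorantValues F).Nonempty :=
  let ⟨u, hu⟩ := exists_majorant F; ⟨u t, u, hu, rfl⟩

theorem majorantValues_nonneg (F : HardySpace Ω α t) : ∀ a ∈ majorantValues F, 0 ≤ a := by
  rintro _ ⟨u, hu, rfl⟩; exact hu.nonneg t t.2

theorem norm_sq (F : HardySpace Ω α t) : ‖F‖ ^ 2 = sInf (majorantValues F) :=
  Real.sq_sqrt (Real.sInf_nonneg (majorantValues_nonneg F))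

theorem norm_nonneg' (F : HardySpace Ω α t) : 0 ≤ ‖F‖ := Real.sqrt_nonneg _

theorem norm_sq_le {F : HardySpace Ω α t} {u : ℂ → ℝ} (hu : IsHarmonicMajorant (toFun F) u) :
    ‖F‖ ^ 2 ≤ u t := by
  rw [norm_sq]; exact csInf_le ⟨0, majorantValues_nonneg F⟩ ⟨u, hu, rfl⟩

theorem exists_lt (F : HardySpace Ω α t) {a : ℝ} (ha : ‖F‖ < a) :
    ∃ u, IsHarmonicMajorant (toFun F) u ∧ u t < a ^ 2 := by
  have : sInf (majorantValues F) < a ^ 2 := by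
    rw [← norm_sq]; have := norm_nonneg' F; gcongr
  obtain ⟨_, ⟨u, hu, rfl⟩, h⟩ := exists_lt_of_csInf_lt (majorantValues_nonempty F) this
  exact ⟨u, hu, h⟩

theorem exists_lt_add (F : HardySpace Ω α t) {ε : ℝ} (hε : 0 < ε) :
    ∃ u, IsHarmonicMajorant (toFun F) u ∧ u t < ‖F‖ ^ 2 + ε := by
  have : sInf (majorantValues F) < ‖F‖ ^ 2 + ε := by rw [← norm_sq]; linarith
  obtain ⟨_, ⟨u, hu, rfl⟩, h⟩ := exists_lt_of_csInf_lt (majorantValues_nonempty F) this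
  exact ⟨u, hu, h⟩

theorem eval_bound {z : ℂ} (hz : z ∈ Ω.carrier) : ∃ C > 0, ∃ r > 0,
    Metric.closedBall z r ⊆ Ω.carrier ∧ ∀ (F : HardySpace Ω α t) (x : Ω.Cover),
      x.pt ∈ Metric.closedBall z r → ‖toFun F x‖ ≤ C * ‖F‖ := by
  obtain ⟨C, hC, r, hr, hrΩ, h⟩ :=
    Potential.harnack Ω.isOpen Ω.isConnected.isPreconnected t.2 hz
  refine ⟨√C, Real.sqrt_pos.2 hC, r, hr, hrΩ, fun F x hx => ?_⟩
  have hsq : ‖toFun F x‖ ^ 2 ≤ C * ‖F‖ ^ 2 := by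
    refine le_of_forall_pos_le_add fun ε hε => ?_
    obtain ⟨u, hu, hlt⟩ := exists_lt_add F (ε := ε / C) (by positivity)
    have h1 := hu.le x
    have h2 := h u hu.harmonic hu.nonneg x.pt hx
    have h3 : C * u t ≤ C * (‖F‖ ^ 2 + ε / C) := by gcongr
    rw [mul_add, mul_div_cancel₀ _ hC.ne'] at h3
    linarith
  have := norm_nonneg' F
  rw [← abs_of_nonneg (norm_nonneg (toFun F x)), ← abs_of_nonneg this, ← Real.sqrt_sq_eq_abs,
    ← Real.sqrt_sq_eq_abs, ← Real.sqrt_mul hC.le]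
  exact Real.sqrt_le_sqrt hsq

theorem norm_smul_le' (c : ℂ) (F : HardySpace Ω α t) : ‖c • F‖ ≤ ‖c‖ * ‖F‖ := by
  have hF := norm_nonneg' F
  refine le_of_sq_le_sq ?_ (by positivity)
  refine le_of_forall_pos_le_add fun ε hε => ?_
  obtain ⟨u, hu, hlt⟩ := exists_lt_add F (ε := ε / (‖c‖ ^ 2 + 1)) (by positivity)
  have h : IsHarmonicMajorant (toFun (c • F)) ((‖c‖ ^ 2) • u) :=
    ⟨hu.harmonic.const_smul, fun x => by
      simp only [map_smul, Pi.smul_apply, smul_eq_mul, norm_mul, mul_pow]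
      exact mul_le_mul_of_nonneg_left (hu.le x) (sq_nonneg _)⟩
  refine (norm_sq_le h).trans ?_
  simp only [Pi.smul_apply, smul_eq_mul]
  have h1 : ‖c‖ ^ 2 * u t ≤ ‖c‖ ^ 2 * (‖F‖ ^ 2 + ε / (‖c‖ ^ 2 + 1)) := by gcongr
  have h2 : ‖c‖ ^ 2 * (ε / (‖c‖ ^ 2 + 1)) ≤ ε := by
    rw [← mul_div_assoc, div_le_iff₀ (by positivity)]; nlinarith
  nlinarith

theorem norm_smul' (c : ℂ) (F : HardySpace Ω α t) : ‖c • F‖ = ‖c‖ * ‖F‖ := by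
  refine le_antisymm (norm_smul_le' c F) ?_
  rcases eq_or_ne c 0 with rfl | hc
  · simpa using norm_nonneg' _
  · have h := norm_smul_le' c⁻¹ (c • F)
    rw [smul_smul, inv_mul_cancel₀ hc, one_smul, norm_inv] at h
    have hc' : 0 < ‖c‖ := norm_pos_iff.2 hc
    calc ‖c‖ * ‖F‖ ≤ ‖c‖ * (‖c‖⁻¹ * ‖c • F‖) := by gcongr
      _ = ‖c • F‖ := mul_inv_cancel_left₀ hc'.ne' _

theorem norm_add_le' (F G : HardySpace Ω α t) : ‖F + G‖ ≤ ‖F‖ + ‖G‖ := by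
  have hF := norm_nonneg' F
  have hG := norm_nonneg' G
  refine le_of_forall_pos_le_add fun ε hε => ?_
  obtain ⟨u, hu, hult⟩ := exists_lt F (a := ‖F‖ + ε / 2) (by linarith)
  obtain ⟨v, hv, hvlt⟩ := exists_lt G (a := ‖G‖ + ε / 2) (by linarith)
  set a := ‖F‖ + ε / 2
  set b := ‖G‖ + ε / 2
  have ha : 0 < a := by positivity
  have hb : 0 < b := by positivity
  have h : IsHarmonicMajorant (toFun (F + G)) ((1 + b / a) • u + (1 + a / b) • v) :=
    ⟨hu.harmonic.const_smul.add hv.harmonic.const_smul, fun x => by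
      simp only [map_add, Pi.add_apply, Pi.smul_apply, smul_eq_mul]
      have h1 : (1 + b / a) * ‖toFun F x‖ ^ 2 ≤ (1 + b / a) * u x.pt := by
        have := hu.le x; gcongr
      have h2 : (1 + a / b) * ‖toFun G x‖ ^ 2 ≤ (1 + a / b) * v x.pt := by
        have := hv.le x; gcongr
      have h3 : ‖toFun F x + toFun G x‖ ^ 2 ≤ (‖toFun F x‖ + ‖toFun G x‖) ^ 2 := by
        gcongr; exact norm_add_le _ _
      have h4 : 2 * ‖toFun F x‖ * ‖toFun G x‖
          ≤ b / a * ‖toFun F x‖ ^ 2 + a / b * ‖toFun G x‖ ^ 2 := by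
        have : b / a * ‖toFun F x‖ ^ 2 + a / b * ‖toFun G x‖ ^ 2
            - 2 * ‖toFun F x‖ * ‖toFun G x‖
            = (b * ‖toFun F x‖ - a * ‖toFun G x‖) ^ 2 / (a * b) := by
          field_simp; ring
        have h5 : 0 ≤ (b * ‖toFun F x‖ - a * ‖toFun G x‖) ^ 2 / (a * b) := by positivity
        linarith
      nlinarith⟩
  have h1 := norm_sq_le h
  simp only [Pi.add_apply, Pi.smul_apply, smul_eq_mul] at h1
  have h2 : (1 + b / a) * u t ≤ (1 + b / a) * a ^ 2 := by gcongr
  have h3 : (1 + a / b) * v t ≤ (1 + a / b) * b ^ 2 := by gcongr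
  have h4 : (1 + b / a) * a ^ 2 + (1 + a / b) * b ^ 2 = (a + b) ^ 2 := by field_simp; ring
  have h5 : ‖F + G‖ ≤ a + b := le_of_sq_le_sq (by linarith) (by positivity)
  have : a + b = ‖F‖ + ‖G‖ + ε := by ring
  linarith

theorem norm_core : NormedSpace.Core ℂ (HardySpace Ω α t) where
  norm_nonneg := norm_nonneg'
  norm_smul := norm_smul'
  norm_triangle := norm_add_le'
  norm_eq_zero_iff F := by
    constructor
    · intro h
      apply toFun_injective
      ext x
      obtain ⟨C, _, r, hr, _, hb⟩ := eval_bound (Ω := Ω) (α := α) (t := t) x.pt_mem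
      have := hb F x (Metric.mem_closedBall_self hr.le)
      rw [h, mul_zero] at this
      simpa using this
    · rintro rfl
      have := norm_smul' (0 : ℂ) (0 : HardySpace Ω α t)
      simpa using this

noncomputable instance : NormedAddCommGroup (HardySpace Ω α t) :=
  NormedAddCommGroup.ofCore norm_core

noncomputable instance : NormedSpace ℂ (HardySpace Ω α t) := NormedSpace.ofCore norm_core

theorem parallelogram_le (F G : HardySpace Ω α t) :
    ‖F + G‖ ^ 2 + ‖F - G‖ ^ 2 ≤ 2 * (‖F‖ ^ 2 + ‖G‖ ^ 2) := by
  refine le_of_forall_pos_le_add fun ε hε => ?_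
  obtain ⟨u, hu, hult⟩ := exists_lt_add F (ε := ε / 4) (by positivity)
  obtain ⟨v, hv, hvlt⟩ := exists_lt_add G (ε := ε / 4) (by positivity)
  set w : ℂ → ℝ := (2 : ℝ) • (u + v) with hw
  have hwh : InnerProductSpace.HarmonicOnNhd w Ω.carrier :=
    (hu.harmonic.add hv.harmonic).const_smul
  obtain ⟨hpc, hps⟩ := (auto (F + G)).modSq_sub
  obtain ⟨hmc, hms⟩ := (auto (F - G)).modSq_sub
  -- separate the two summands by a harmonic function
  obtain ⟨h, hh, hb⟩ := Potential.exists_harmonic_between Ω.isOpen hpc hps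
    (w := w - modSq (toFun (F - G))) (hwh.continuousOn.sub hmc)
    (by
      rw [neg_sub, sub_eq_add_neg]
      exact hms.add Ω.isOpen (Potential.SubMean.of_harmonic Ω.isOpen hwh.neg) hmc
        hwh.continuousOn.neg)
    (fun z hz => by
      obtain ⟨x, rfl⟩ := exists_over hz
      have h1 := hu.le x
      have h2 := hv.le x
      have h3 := parallelogram_law_with_norm ℝ (toFun F x) (toFun G x)
      rw [Pi.sub_apply, (auto (F + G)).modSq_eq, (auto (F - G)).modSq_eq]
      simp only [map_add, map_sub, Pi.sub_apply, Pi.add_apply, hw, Pi.smul_apply, smul_eq_mul]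
      linarith)
  have h1 : IsHarmonicMajorant (toFun (F + G)) h :=
    ⟨hh, fun x => by rw [← (auto (F + G)).modSq_eq]; exact (hb x.pt x.pt_mem).1⟩
  have h2 : IsHarmonicMajorant (toFun (F - G)) (w - h) :=
    ⟨hwh.sub hh, fun x => by
      rw [← (auto (F - G)).modSq_eq]
      have := (hb x.pt x.pt_mem).2
      simp only [Pi.sub_apply] at *
      linarith⟩
  have h3 := norm_sq_le h1
  have h4 := norm_sq_le h2
  simp only [Pi.sub_apply, hw, Pi.smul_apply, Pi.add_apply, smul_eq_mul] at h4
  linarith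

theorem parallelogram (F G : HardySpace Ω α t) :
    ‖F + G‖ * ‖F + G‖ + ‖F - G‖ * ‖F - G‖ = 2 * (‖F‖ * ‖F‖ + ‖G‖ * ‖G‖) := by
  have h1 := parallelogram_le F G
  have h2 := parallelogram_le (F + G) (F - G)
  have e1 : F + G + (F - G) = (2 : ℂ) • F := by rw [two_smul]; abel
  have e2 : F + G - (F - G) = (2 : ℂ) • G := by rw [two_smul]; abel
  rw [e1, e2, norm_smul, norm_smul] at h2
  norm_num at h2
  nlinarith

noncomputable instance : InnerProductSpace ℂ (HardySpace Ω α t) :=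
  InnerProductSpace.ofNorm ℂ parallelogram

instance : CompleteSpace (HardySpace Ω α t) := by
  refine NormedAddCommGroup.completeSpace_of_summable_imp_tendsto fun f hf => ?_
  -- majorants with summable values
  set a : ℕ → ℝ := fun k => ‖f k‖ + (1 / 2) ^ k with ha
  have hapos : ∀ k, 0 < a k := fun k => by positivity
  have hasum : Summable a := hf.add summable_geometric_two
  have hmaj : ∀ k, ∃ u, IsHarmonicMajorant (toFun (f k)) u ∧ u t < a k ^ 2 := fun k =>
    exists_lt (f k) (by simp only [ha]; have : (0 : ℝ) < (1 / 2) ^ k := by positivity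
                        linarith)
  choose u hu hult using hmaj
  set v : ℕ → ℂ → ℝ := fun k => (a k)⁻¹ • u k with hv
  have hvh : ∀ k, InnerProductSpace.HarmonicOnNhd (v k) Ω.carrier := fun k =>
    (hu k).harmonic.const_smul
  have hv0 : ∀ k, ∀ z ∈ Ω.carrier, 0 ≤ v k z := fun k z hz =>
    mul_nonneg (inv_nonneg.2 (hapos k).le) ((hu k).nonneg z hz)
  have hvt : ∀ k, v k t ≤ a k := fun k => by
    simp only [hv, Pi.smul_apply, smul_eq_mul]
    rw [inv_mul_le_iff₀ (hapos k), ← sq]; exact (hult k).le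
  have hvs : Summable fun k => v k t :=
    Summable.of_nonneg_of_le (fun k => hv0 k t t.2) hvt hasum
  have hfv : ∀ k (x : Ω.Cover), ‖toFun (f k) x‖ ^ 2 ≤ a k * v k x.pt := fun k x => by
    simp only [hv, Pi.smul_apply, smul_eq_mul]
    rw [mul_inv_cancel_left₀ (hapos k).ne']; exact (hu k).le x
  -- pointwise summability, locally uniformly
  have hsum : ∀ x : Ω.Cover, Summable fun k => ‖toFun (f k) x‖ := fun x => by
    obtain ⟨C, hC, r, hr, _, hb⟩ := eval_bound (Ω := Ω) (α := α) (t := t) x.pt_mem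
    exact Summable.of_nonneg_of_le (fun _ => norm_nonneg _)
      (fun k => hb (f k) x (Metric.mem_closedBall_self hr.le)) (hf.mul_left C)
  set G : Ω.Cover → ℂ := fun x => ∑' k, toFun (f k) x with hG
  have hGauto : IsModulusAutomorphic α G := by
    constructor
    · intro U s hU hs hsz z hz
      have hzΩ : z ∈ Ω.carrier := by rw [← hsz z hz]; exact (s z).pt_mem
      obtain ⟨C, hC, r, hr, _, hb⟩ := eval_bound (Ω := Ω) (α := α) (t := t) hzΩ
      have hV : IsOpen (U ∩ Metric.ball z r) := hU.inter Metric.isOpen_ball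
      have hd : DifferentiableOn ℂ (fun w => ∑' k, toFun (f k) (s w)) (U ∩ Metric.ball z r) :=
        Complex.differentiableOn_tsum_of_summable_norm (hf.mul_left C)
          (fun k => ((auto (f k)).holomorphic U s hU hs hsz).mono Set.inter_subset_left) hV
          (fun k w hw => hb (f k) (s w) (by
            rw [hsz w hw.1]; exact Metric.ball_subset_closedBall hw.2))
      exact (hd.differentiableAt (hV.mem_nhds ⟨hz, Metric.mem_ball_self hr⟩)).differentiableWithinAt
    · intro x n
      simp only [hG, (auto (f _)).automorphy]
      rw [tsum_mul_left]
  -- Cauchy-Schwarz estimate of the tails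
  have htail : ∀ n (x : Ω.Cover), ‖∑' k, toFun (f (k + n)) x‖ ^ 2
      ≤ (∑' k, a (k + n)) * ∑' k, v (k + n) x.pt := by
    intro n x
    have hvx : Summable fun k => v k x.pt :=
      (Potential.harmonic_tsum Ω.isOpen Ω.isConnected.isPreconnected t.2 hvh hv0 hvs).1 x.pt x.pt_mem
    have ha' : Summable fun k => a (k + n) := (summable_nat_add_iff n).2 hasum
    have hv' : Summable fun k => v (k + n) x.pt := (summable_nat_add_iff n).2 hvx
    have hs' : Summable fun k => ‖toFun (f (k + n)) x‖ :=
      (summable_nat_add_iff (f := fun k => ‖toFun (f k) x‖) n).2 (hsum x)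
    have h1 : ‖∑' k, toFun (f (k + n)) x‖ ≤ ∑' k, ‖toFun (f (k + n)) x‖ := norm_tsum_le_tsum_norm hs'
    have h2 : (∑' k, ‖toFun (f (k + n)) x‖) ^ 2 ≤ (∑' k, a (k + n)) * ∑' k, v (k + n) x.pt := by
      refine le_of_tendsto (hs'.hasSum.tendsto_sum_nat.pow 2)
        (Filter.Eventually.of_forall fun N => ?_)
      refine (Finset.sum_sq_le_sum_mul_sum_of_sq_le_mul (Finset.range N)
        (fun k _ => (hapos _).le) (fun k _ => hv0 (k + n) _ x.pt_mem)
        (fun k _ => hfv (k + n) x)).trans ?_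
      exact mul_le_mul (ha'.sum_le_tsum _ fun k _ => (hapos _).le)
        (hv'.sum_le_tsum _ fun k _ => hv0 _ _ x.pt_mem)
        (Finset.sum_nonneg fun k _ => hv0 _ _ x.pt_mem) (tsum_nonneg fun k => (hapos _).le)
    have h3 : ‖∑' k, toFun (f (k + n)) x‖ ^ 2 ≤ (∑' k, ‖toFun (f (k + n)) x‖) ^ 2 := by gcongr
    exact h3.trans h2
  have htailh : ∀ n, InnerProductSpace.HarmonicOnNhd (fun z => ∑' k, v (k + n) z) Ω.carrier :=
    fun n => (Potential.harmonic_tsum Ω.isOpen Ω.isConnected.isPreconnected t.2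
      (u := fun k => v (k + n)) (fun k => hvh _) (fun k => hv0 _)
      ((summable_nat_add_iff (f := fun k => v k t) n).2 hvs)).2
  have hGmem : G ∈ hardySubmodule Ω α := ⟨hGauto, (∑' k, a (k + 0)) • fun z => ∑' k, v (k + 0) z,
    (htailh 0).const_smul, fun x => htail 0 x⟩
  let g : HardySpace Ω α t := ⟨G, hGmem⟩
  refine ⟨g, ?_⟩
  rw [tendsto_iff_norm_sub_tendsto_zero]
  have hbound : ∀ n, ‖∑ i ∈ Finset.range n, f i - g‖ ≤ ∑' k, a (k + n) := by
    intro n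
    have hA : 0 ≤ ∑' k, a (k + n) := tsum_nonneg fun k => (hapos _).le
    have hm : IsHarmonicMajorant (toFun (g - ∑ i ∈ Finset.range n, f i))
        ((∑' k, a (k + n)) • fun z => ∑' k, v (k + n) z) := by
      refine ⟨(htailh n).const_smul, fun x => ?_⟩
      have : toFun (g - ∑ i ∈ Finset.range n, f i) x = ∑' k, toFun (f (k + n)) x := by
        rw [map_sub, map_sum, Pi.sub_apply, Finset.sum_apply, sub_eq_iff_eq_add', eq_comm]
        exact (hsum x).of_norm.sum_add_tsum_nat_add n
      rw [this]
      exact htail n x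
    have h1 := norm_sq_le hm
    have h2 : (∑' k, v (k + n) (t : ℂ)) ≤ ∑' k, a (k + n) :=
      ((summable_nat_add_iff (f := fun k => v k t) n).2 hvs).tsum_le_tsum (fun k => hvt _)
        ((summable_nat_add_iff n).2 hasum)
    rw [norm_sub_rev]
    refine le_of_sq_le_sq (h1.trans ?_) hA
    simp only [Pi.smul_apply, smul_eq_mul]
    rw [sq]
    exact mul_le_mul_of_nonneg_left h2 hA
  exact squeeze_zero (fun _ => norm_nonneg _) hbound (tendsto_sum_nat_add a)

/-- `H²_α(Ω)` is a reproducing kernel Hilbert space of functions on the covering surface. -/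
noncomputable instance : RKHS ℂ (HardySpace Ω α t) Ω.Cover ℂ where
  coeCLM := ⟨toFun, continuous_pi fun x => by
    obtain ⟨C, hC, r, hr, _, hb⟩ := eval_bound (Ω := Ω) (α := α) (t := t) x.pt_mem
    exact AddMonoidHomClass.continuous_of_bound ((LinearMap.proj x).comp toFun) C
      fun F => hb F x (Metric.mem_closedBall_self hr.le)⟩
  coeCLM_injective := toFun_injective

end HardySpace

/- Part 3. The operator `M`, the kernel `K_α`, the algebra `𝒜(Ω)` and dilations. -/

namespace HardySpace

open PlanarDomain

variable {m : ℕ} (Ω : PlanarDomain m) (α : Fin m → Circle) (t : Ω.carrier)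

/-- The operator `M` of multiplication by the independent variable on `H²_α(Ω)`. -/
noncomputable def mulZ : HardySpace Ω α t →L[ℂ] HardySpace Ω α t :=
  LinearMap.mkContinuousOfExistsBound
    { toFun := fun F => ⟨fun x => x.pt * toFun F x,
        ⟨fun U s hU hs hsz => (differentiableOn_id.mul ((auto F).holomorphic U s hU hs hsz)).congr
            fun z hz => by simp [hsz z hz],
          fun x n => by
            rw [(auto F).automorphy]
            exact mul_left_comm _ _ _⟩,
        by
          obtain ⟨u, hu⟩ := exists_majorant F
          obtain ⟨C, hC⟩ := Ω.isBounded.exists_norm_le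
          refine ⟨(C ^ 2) • u, hu.harmonic.const_smul, fun x => ?_⟩
          rw [norm_mul, mul_pow]
          have h1 := hu.le x
          have h2 := hC x.pt x.pt_mem
          simp only [Pi.smul_apply, smul_eq_mul]
          gcongr⟩
      map_add' := fun F G => toFun_injective (by
        ext x
        exact (congrArg (x.pt * ·) (congrFun (map_add toFun F G) x)).trans (mul_add _ _ _))
      map_smul' := fun c F => toFun_injective (by
        ext x
        exact (congrArg (x.pt * ·) (congrFun (map_smul toFun c F) x)).trans
          (mul_left_comm _ _ _)) }
    (by
      obtain ⟨C, hC⟩ := Ω.isBounded.exists_norm_le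
      have hC0 : 0 ≤ C := (norm_nonneg _).trans (hC t t.2)
      refine ⟨C, fun F => ?_⟩
      refine le_of_forall_pos_le_add fun ε hε => ?_
      obtain ⟨u, hu, hlt⟩ := exists_lt F (a := ‖F‖ + ε / (C + 1))
        (lt_add_of_pos_right _ (by positivity))
      refine (?_ : _ ≤ C * (‖F‖ + ε / (C + 1))).trans ?_
      · refine le_of_sq_le_sq ((norm_sq_le (u := (C ^ 2) • u) ⟨hu.harmonic.const_smul,
          fun x => ?_⟩).trans ?_) (by positivity)
        · change ‖x.pt * toFun F x‖ ^ 2 ≤ _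
          rw [norm_mul, mul_pow]
          have h1 := hu.le x
          have h2 := hC x.pt x.pt_mem
          simp only [Pi.smul_apply, smul_eq_mul]
          gcongr
        · simp only [Pi.smul_apply, smul_eq_mul, mul_pow]
          gcongr
      · have : C * (ε / (C + 1)) ≤ ε := by
          rw [← mul_div_assoc, div_le_iff₀ (by positivity)]; nlinarith
        linarith)

theorem mulZ_apply (F : HardySpace Ω α t) (x : Ω.Cover) :
    toFun (mulZ Ω α t F) x = x.pt * toFun F x := rfl

/-- The reproducing kernel `K_α` of `H²_α(Ω)`: the function `K_α(·, y)` is the element of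
`H²_α(Ω)` with `F(y) = ⟨F, K_α(·, y)⟩` for all `F`. -/
noncomputable def kernel (x y : Ω.Cover) : ℂ := RKHS.kernel (HardySpace Ω α t) x y 1

open scoped TensorProduct in
/-- The operator `M ⊗ I` on the Hilbert space `H²_α(Ω) ⊗ ℂⁿ`. -/
noncomputable def mulZTensor (n : ℕ) :
    (HardySpace Ω α t ⊗[ℂ] EuclideanSpace ℂ (Fin n)) →L[ℂ]
      (HardySpace Ω α t ⊗[ℂ] EuclideanSpace ℂ (Fin n)) :=
  TensorProduct.mapL (mulZ Ω α t) (ContinuousLinearMap.id ℂ (EuclideanSpace ℂ (Fin n)))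

end HardySpace

namespace PlanarDomain

variable {m : ℕ} (Ω : PlanarDomain m)

instance : CompactSpace (closure Ω.carrier) :=
  isCompact_iff_compactSpace.1 Ω.isBounded.isCompact_closure

/-- The rational function `p / q`, without poles on `closure Ω`. -/
noncomputable def ratFun (p q : Polynomial ℂ) (hq : ∀ z ∈ closure Ω.carrier, q.eval z ≠ 0) :
    C(closure Ω.carrier, ℂ) where
  toFun z := p.eval z.1 / q.eval z.1
  continuous_toFun := (p.continuous.comp continuous_subtype_val).div
    (q.continuous.comp continuous_subtype_val) fun z => hq z z.2

/-- The algebra `Rat(Ω)` of rational functions without poles on `closure Ω`. -/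
noncomputable def ratAlgebra : Subalgebra ℂ C(closure Ω.carrier, ℂ) where
  carrier := {f | ∃ p q hq, f = Ω.ratFun p q hq}
  mul_mem' := by
    rintro _ _ ⟨p, q, hq, rfl⟩ ⟨p', q', hq', rfl⟩
    refine ⟨p * p', q * q', fun z hz => by simp [hq z hz, hq' z hz], ?_⟩
    ext z
    simp [ratFun, div_mul_div_comm]
  add_mem' := by
    rintro _ _ ⟨p, q, hq, rfl⟩ ⟨p', q', hq', rfl⟩
    refine ⟨p * q' + q * p', q * q', fun z hz => by simp [hq z hz, hq' z hz], ?_⟩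
    ext z
    simp [ratFun, div_add_div _ _ (hq z z.2) (hq' z z.2)]
  algebraMap_mem' c := ⟨Polynomial.C c, 1, by simp, by ext z; simp [ratFun]⟩

/-- The algebra `𝒜(Ω)`: the closure of `Rat(Ω)` with respect to the supremum norm, realized as a
closed subalgebra of the continuous functions on the compact set `closure Ω`. -/
noncomputable def planarAlgebra : Subalgebra ℂ C(closure Ω.carrier, ℂ) :=
  Ω.ratAlgebra.topologicalClosure

/-- The rational function `p / q` as an element of `𝒜(Ω)`. -/
noncomputable def rat (p q : Polynomial ℂ) (hq : ∀ z ∈ closure Ω.carrier, q.eval z ≠ 0) :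
    Ω.planarAlgebra :=
  ⟨Ω.ratFun p q hq, Subalgebra.le_topologicalClosure _ ⟨p, q, hq, rfl⟩⟩

variable {Ω}

/-- `ρ` is the homomorphism of `𝒜(Ω)` induced by the operator `a`, i.e. the continuous extension
of `p / q ↦ p(a) q(a)⁻¹` from `Rat(Ω)` to `𝒜(Ω)`. -/
structure IsInducedBy {B : Type*} [NormedRing B] [NormedAlgebra ℂ B] (ρ : Ω.planarAlgebra →ₐ[ℂ] B)
    (a : B) : Prop where
  continuous : Continuous ρ
  isUnit : ∀ q : Polynomial ℂ, (∀ z ∈ closure Ω.carrier, q.eval z ≠ 0) →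
    IsUnit (Polynomial.aeval a q)
  rat : ∀ (p q : Polynomial ℂ) (hq : ∀ z ∈ closure Ω.carrier, q.eval z ≠ 0),
    ρ (Ω.rat p q hq) = Polynomial.aeval a p * Ring.inverse (Polynomial.aeval a q)

/-- `ρ` dilates to `ρ'`: up to an isometric embedding `Γ` of the space `V` of `ρ` into the space
`H` of `ρ'`, each `ρ f` is the compression of `ρ' f`, that is `ρ f = P (ρ' f)|_V`, where `P` is the
orthogonal projection onto `V`. -/
def DilatesTo {V H : Type*} [NormedAddCommGroup V] [InnerProductSpace ℂ V]
    [NormedAddCommGroup H] [InnerProductSpace ℂ H]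
    (ρ : Ω.planarAlgebra →ₐ[ℂ] (V →L[ℂ] V)) (ρ' : Ω.planarAlgebra →ₐ[ℂ] (H →L[ℂ] H)) : Prop :=
  ∃ Γ : V →ₗᵢ[ℂ] H, ∀ (f : Ω.planarAlgebra) (v w : V),
    inner ℂ (Γ w) (ρ' f (Γ v)) = inner ℂ w (ρ f v)

end PlanarDomain

open scoped ComplexOrder TensorProduct Matrix

/-!
The eigenvectors `v i` of `T*` form a basis of `V`, and a positive semidefinite matrix is a Gram
matrix, `A i j = ⟪b j, b i⟫` with `b i ∈ ℂⁿ`. The hypothesis that the kernel of `T` is the Schur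
product of `A` and of the restriction of `K_α` thus says that the vectors `v i` and
`k i ⊗ b i`, where `k i = K_α(·, x i)`, have the same Gram matrix. Hence `v i ↦ k i ⊗ b i` extends
to an isometry `Γ : V → H²_α(Ω) ⊗ ℂⁿ`.

Every `f ∈ 𝒜(Ω)` is holomorphic on `Ω` and bounded by its supremum norm, so multiplication by `f`
is an operator on `H²_α(Ω)` of norm at most `‖f‖` (`HardySpace.mulBy`); tensoring with the identity
gives the homomorphism `HardySpace.tensorHom` induced by `M ⊗ I`. The reproducing property makes
`k i ⊗ b i` an eigenvector of its adjoint at `f`, with eigenvalue `conj (f (z i))`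
(`HardySpace.inner_kerFun_tmul_tensorHom`). The homomorphism induced by `T` is diagonal in the
coordinates `u ↦ ⟪v i, u⟫` with entries `f (z i)` (`PlanarDomain.diagonalHom`), so each `v i` is an
eigenvector of its adjoint at `f` with the same eigenvalue. Therefore `Γ` intertwines the adjoints
on the basis `v`, which is the asserted dilation.
-/

namespace PlanarDomain

variable {m : ℕ} {Ω : PlanarDomain m}

/-! ### Homomorphisms induced by an operator -/

/-- A continuous homomorphism of `𝒜(Ω)` is induced by its value at the coordinate function. -/
theorem isInducedBy_of_continuous {B : Type*} [NormedRing B] [NormedAlgebra ℂ B]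
    (ρ : Ω.planarAlgebra →ₐ[ℂ] B) (hρ : Continuous ρ) {a : B}
    (ha : ρ (Ω.rat Polynomial.X 1 (by simp)) = a) : IsInducedBy ρ a := by
  have h1 : ∀ p : Polynomial ℂ, ρ (Ω.rat p 1 (by simp)) = Polynomial.aeval a p := by
    intro p
    rw [← ha, Polynomial.aeval_algHom_apply]
    congr 1
    ext z
    have e := congrArg (fun f : C(closure Ω.carrier, ℂ) => f z)
      (Polynomial.aeval_algHom_apply Ω.planarAlgebra.val (Ω.rat Polynomial.X 1 (by simp)) p)
    have e' := Polynomial.aeval_algHom_apply (ContinuousMap.evalAlgHom ℂ ℂ z)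
      (Ω.planarAlgebra.val (Ω.rat Polynomial.X 1 (by simp))) p
    rw [Subalgebra.val_apply] at e
    refine Eq.trans ?_ e
    refine Eq.trans ?_ e'
    simp [rat, ratFun, Polynomial.aeval_def, Polynomial.eval₂_eq_eval_map]
  have h2 : ∀ (q : Polynomial ℂ) (hq : ∀ z ∈ closure Ω.carrier, q.eval z ≠ 0),
      Polynomial.aeval a q * ρ (Ω.rat 1 q hq) = 1 := by
    intro q hq
    rw [← h1, ← map_mul, ← map_one ρ]
    congr 1
    ext z
    simp [rat, ratFun, hq z z.2]
  have h3 : ∀ (q : Polynomial ℂ) (hq : ∀ z ∈ closure Ω.carrier, q.eval z ≠ 0),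
      ρ (Ω.rat 1 q hq) * Polynomial.aeval a q = 1 := by
    intro q hq
    rw [← h2 q hq, ← h1, ← map_mul, ← map_mul, mul_comm]
  refine ⟨hρ, fun q hq => ⟨⟨_, _, h2 q hq, h3 q hq⟩, rfl⟩, fun p q hq => ?_⟩
  have h4 : Ring.inverse (Polynomial.aeval a q) = ρ (Ω.rat 1 q hq) :=
    Ring.inverse_unit ⟨_, _, h2 q hq, h3 q hq⟩
  rw [h4, ← h1, ← map_mul]
  congr 1
  ext z
  simp [rat, ratFun, div_eq_mul_inv]

/-- The homomorphism of `𝒜(Ω)` that is diagonal with entries `f (z i)` in the coordinates given by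
a linear equivalence `Φ : V ≃ ℂⁿ`. -/
noncomputable def diagonalHom {V ι : Type*} [NormedAddCommGroup V] [InnerProductSpace ℂ V]
    [FiniteDimensional ℂ V] (Φ : V ≃ₗ[ℂ] (ι → ℂ)) (z : ι → closure Ω.carrier) :
    Ω.planarAlgebra →ₐ[ℂ] (V →L[ℂ] V) :=
  (Module.End.toContinuousLinearMap V : Module.End ℂ V ≃ₐ[ℂ] (V →L[ℂ] V)).toAlgHom.comp <|
    (Φ.symm.conjAlgEquiv ℂ).toAlgHom.comp <| (Algebra.lmul ℂ (ι → ℂ)).comp <|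
      AlgHom.pi fun i => (ContinuousMap.evalAlgHom ℂ ℂ (z i)).comp Ω.planarAlgebra.val

theorem diagonalHom_apply {V ι : Type*} [NormedAddCommGroup V] [InnerProductSpace ℂ V]
    [FiniteDimensional ℂ V] (Φ : V ≃ₗ[ℂ] (ι → ℂ)) (z : ι → closure Ω.carrier)
    (f : Ω.planarAlgebra) (u : V) (i : ι) :
    Φ (diagonalHom Φ z f u) i = f.1 (z i) * Φ u i :=
  congrFun (Φ.apply_symm_apply fun j => f.1 (z j) * Φ u j) i

theorem continuous_diagonalHom {V ι : Type*} [Finite ι] [NormedAddCommGroup V]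
    [InnerProductSpace ℂ V] [FiniteDimensional ℂ V] (Φ : V ≃ₗ[ℂ] (ι → ℂ))
    (z : ι → closure Ω.carrier) : Continuous (diagonalHom Φ z) := by
  cases nonempty_fintype ι
  -- the map factors through point evaluations and a linear map on the finite-dimensional `ι → ℂ`
  let L : (ι → ℂ) →ₗ[ℂ] (V →L[ℂ] V) :=
    ((Module.End.toContinuousLinearMap V : Module.End ℂ V ≃ₐ[ℂ] (V →L[ℂ] V)).toAlgHom.comp <|
      (Φ.symm.conjAlgEquiv ℂ).toAlgHom.comp <| (Algebra.lmul ℂ (ι → ℂ))).toLinearMap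
  exact L.continuous_of_finiteDimensional.comp (continuous_pi fun i =>
    (continuous_eval_const (z i)).comp continuous_subtype_val)

/-! ### Multiplication by functions of the algebra `𝒜(Ω)` -/

/-- The elements of `𝒜(Ω)` are holomorphic on `Ω`. The extension by zero outside the closure of `Ω`
only serves to speak of differentiability. -/
theorem differentiableOn_of_mem_planarAlgebra {f : C(closure Ω.carrier, ℂ)}
    (hf : f ∈ Ω.planarAlgebra) :
    DifferentiableOn ℂ (Function.extend Subtype.val f 0) Ω.carrier := by
  have hval : ∀ (g : C(closure Ω.carrier, ℂ)) (z : ℂ) (hz : z ∈ Ω.carrier),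
      Function.extend Subtype.val g 0 z = g ⟨z, subset_closure hz⟩ := fun g z hz =>
    Subtype.val_injective.extend_apply g 0 ⟨z, subset_closure hz⟩
  obtain ⟨g, hg, hlim⟩ := mem_closure_iff_seq_limit.1 hf
  refine TendstoLocallyUniformlyOn.differentiableOn (φ := Filter.atTop)
    (F := fun n => Function.extend Subtype.val (g n) 0) ?_
    (Filter.Eventually.of_forall fun n => ?_) Ω.isOpen
  · refine TendstoUniformlyOn.tendstoLocallyUniformlyOn ?_
    rw [Metric.tendstoUniformlyOn_iff]
    intro ε hε
    filter_upwards [(Metric.tendsto_nhds.1 hlim) ε hε] with n hn z hz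
    rw [hval _ z hz, hval _ z hz, dist_comm]
    exact (ContinuousMap.dist_apply_le_dist _).trans_lt hn
  · obtain ⟨p, q, hq, h⟩ := hg n
    refine DifferentiableOn.congr (f := fun z => p.eval z / q.eval z)
      (p.differentiable.differentiableOn.div q.differentiable.differentiableOn
        fun z hz => hq z (subset_closure hz)) fun z hz => ?_
    rw [hval _ z hz, h]
    rfl

/-- The point of the closure of `Ω` under a point of the covering surface. -/
def Cover.clPt (x : Ω.Cover) : closure Ω.carrier := ⟨x.pt, subset_closure x.pt_mem⟩

end PlanarDomain

namespace HardySpace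

open PlanarDomain
open scoped TensorProduct

variable {m : ℕ} {Ω : PlanarDomain m} {α : Fin m → Circle} {t : Ω.carrier}

theorem isHarmonicMajorant_mul (f : C(closure Ω.carrier, ℂ)) {F : HardySpace Ω α t} {u : ℂ → ℝ}
    (hu : IsHarmonicMajorant (toFun F) u) :
    IsHarmonicMajorant (fun x => f x.clPt * toFun F x) ((‖f‖ ^ 2) • u) := by
  refine ⟨hu.harmonic.const_smul, fun x => ?_⟩
  rw [norm_mul, mul_pow]
  have h1 := hu.le x
  have h2 := f.norm_coe_le_norm x.clPt
  simp only [Pi.smul_apply, smul_eq_mul]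
  gcongr

variable (α t) in
/-- Multiplication by `f ∈ 𝒜(Ω)` as a linear map on `H²_α(Ω)`. -/
noncomputable def mulByLinear (f : Ω.planarAlgebra) :
    HardySpace Ω α t →ₗ[ℂ] HardySpace Ω α t where
  toFun F := ⟨fun x => f.1 x.clPt * toFun F x,
    ⟨fun U s hU hs hsz => by
        have hUΩ : U ⊆ Ω.carrier := fun z hz => hsz z hz ▸ (s z).pt_mem
        refine (((differentiableOn_of_mem_planarAlgebra f.2).mono hUΩ).mul
          ((auto F).holomorphic U s hU hs hsz)).congr fun z hz => ?_
        have h := Subtype.val_injective.extend_apply f.1 0 (s z).clPt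
        rw [show ((s z).clPt : ℂ) = z from hsz z hz] at h
        simp only [Pi.mul_apply, h],
      fun x n => by
        rw [(auto F).automorphy]
        exact mul_left_comm _ _ _⟩,
    let ⟨_, hu⟩ := exists_majorant F
    ⟨_, isHarmonicMajorant_mul f.1 hu⟩⟩
  map_add' F G := toFun_injective (by
    ext x
    exact (congrArg (f.1 x.clPt * ·) (congrFun (map_add toFun F G) x)).trans (mul_add _ _ _))
  map_smul' c F := toFun_injective (by
    ext x
    exact (congrArg (f.1 x.clPt * ·) (congrFun (map_smul toFun c F) x)).trans
      (mul_left_comm _ _ _))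

theorem norm_mulByLinear_le (f : Ω.planarAlgebra) (F : HardySpace Ω α t) :
    ‖mulByLinear α t f F‖ ≤ ‖f‖ * ‖F‖ := by
  refine le_of_sq_le_sq (le_of_forall_pos_le_add fun ε hε => ?_) (by positivity)
  obtain ⟨u, hu, hlt⟩ := exists_lt_add F (ε := ε / (‖f‖ ^ 2 + 1)) (by positivity)
  have h1 : ‖mulByLinear α t f F‖ ^ 2 ≤ ‖f‖ ^ 2 * u t :=
    norm_sq_le (F := mulByLinear α t f F) (isHarmonicMajorant_mul f.1 hu)
  have h2 : ‖f‖ ^ 2 * u t ≤ ‖f‖ ^ 2 * (‖F‖ ^ 2 + ε / (‖f‖ ^ 2 + 1)) := by gcongr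
  have h3 : ‖f‖ ^ 2 * (ε / (‖f‖ ^ 2 + 1)) ≤ ε := by
    rw [← mul_div_assoc, div_le_iff₀ (by positivity)]; nlinarith
  nlinarith

variable (α t) in
/-- Multiplication by `f ∈ 𝒜(Ω)` as a bounded operator on `H²_α(Ω)`. -/
noncomputable def mulBy (f : Ω.planarAlgebra) : HardySpace Ω α t →L[ℂ] HardySpace Ω α t :=
  (mulByLinear α t f).mkContinuous ‖f‖ (norm_mulByLinear_le f)

theorem mulBy_apply (f : Ω.planarAlgebra) (F : HardySpace Ω α t) (x : Ω.Cover) :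
    toFun (mulBy α t f F) x = f.1 x.clPt * toFun F x := rfl

theorem norm_mulBy_le (f : Ω.planarAlgebra) : ‖mulBy α t f‖ ≤ ‖f‖ :=
  LinearMap.mkContinuous_norm_le _ (norm_nonneg _) _

variable (α t) in
/-- The homomorphism of `𝒜(Ω)` into the operators on `H²_α(Ω)` by multiplication. -/
noncomputable def mulHom : Ω.planarAlgebra →ₐ[ℂ] (HardySpace Ω α t →L[ℂ] HardySpace Ω α t) :=
  AlgHom.ofLinearMap
    { toFun := mulBy α t
      map_add' := fun f g => ContinuousLinearMap.ext fun F => toFun_injective (funext fun x =>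
        (add_mul (f.1 x.clPt) (g.1 x.clPt) _).trans
          (congrFun (map_add toFun (mulBy α t f F) (mulBy α t g F)) x).symm)
      map_smul' := fun c f => ContinuousLinearMap.ext fun F => toFun_injective (funext fun x =>
        (mul_assoc c (f.1 x.clPt) _).trans
          (congrFun (map_smul toFun c (mulBy α t f F)) x).symm) }
    (ContinuousLinearMap.ext fun _ => toFun_injective (funext fun _ => one_mul _))
    (fun f g => ContinuousLinearMap.ext fun _ => toFun_injective (funext fun x =>
      mul_assoc (f.1 x.clPt) (g.1 x.clPt) _))

variable (α t) in
/-- The homomorphism `f ↦ (multiplication by f) ⊗ I` of `𝒜(Ω)` into the operators on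
`H²_α(Ω) ⊗ ℂⁿ`. -/
noncomputable def tensorHom (n : ℕ) : Ω.planarAlgebra →ₐ[ℂ]
    ((HardySpace Ω α t ⊗[ℂ] EuclideanSpace ℂ (Fin n)) →L[ℂ]
      (HardySpace Ω α t ⊗[ℂ] EuclideanSpace ℂ (Fin n))) :=
  AlgHom.ofLinearMap
    { toFun := fun f => TensorProduct.mapL (mulHom α t f) (.id ℂ (EuclideanSpace ℂ (Fin n)))
      map_add' := fun f g => by rw [map_add, TensorProduct.mapL_add_left]
      map_smul' := fun c f => by rw [map_smul, TensorProduct.mapL_smul_left, RingHom.id_apply] }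
    ((congrArg (TensorProduct.mapL · _) (map_one (mulHom α t))).trans TensorProduct.mapL_id_id)
    (fun f g => (congrArg (TensorProduct.mapL · _) (map_mul (mulHom α t) f g)).trans
      (TensorProduct.mapL_mul _ _ (.id ℂ _) (.id ℂ _)))

theorem tensorHom_tmul {n : ℕ} (f : Ω.planarAlgebra) (F : HardySpace Ω α t)
    (b : EuclideanSpace ℂ (Fin n)) :
    tensorHom α t n f (F ⊗ₜ b) = mulBy α t f F ⊗ₜ b := rfl

theorem norm_tensorHom_le {n : ℕ} (f : Ω.planarAlgebra) : ‖tensorHom α t n f‖ ≤ ‖f‖ :=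
  calc ‖tensorHom α t n f‖
      ≤ ‖mulBy α t f‖ * ‖ContinuousLinearMap.id ℂ (EuclideanSpace ℂ (Fin n))‖ :=
        TensorProduct.norm_mapL_le _ _
    _ ≤ ‖f‖ * 1 := by
        gcongr
        · exact norm_mulBy_le f
        · exact ContinuousLinearMap.norm_id_le
    _ = ‖f‖ := mul_one _

theorem isInducedBy_tensorHom (n : ℕ) :
    IsInducedBy (tensorHom α t n) (mulZTensor Ω α t n) := by
  have hc : Continuous (tensorHom (Ω := Ω) α t n) :=
    AddMonoidHomClass.continuous_of_bound (tensorHom α t n) 1 fun f =>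
      (norm_tensorHom_le f).trans_eq (one_mul _).symm
  refine isInducedBy_of_continuous _ hc ?_
  refine congrArg (TensorProduct.mapL · (.id ℂ _)) (ContinuousLinearMap.ext fun F =>
    toFun_injective (funext fun x => ?_))
  rw [mulZ_apply]
  refine (mulBy_apply _ F x).trans ?_
  simp [rat, ratFun, Cover.clPt]

/-- The vectors `K_α(·, x) ⊗ b` are eigenvectors of the adjoint of `(multiplication by f) ⊗ I`,
with eigenvalue the conjugate of the value of `f` under `x`. -/
theorem inner_kerFun_tmul_tensorHom {n : ℕ} (f : Ω.planarAlgebra) (x : Ω.Cover)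
    (b : EuclideanSpace ℂ (Fin n)) (y : HardySpace Ω α t ⊗[ℂ] EuclideanSpace ℂ (Fin n)) :
    inner ℂ (RKHS.kerFun (HardySpace Ω α t) x (1 : ℂ) ⊗ₜ[ℂ] b) (tensorHom α t n f y) =
      f.1 x.clPt * inner ℂ (RKHS.kerFun (HardySpace Ω α t) x (1 : ℂ) ⊗ₜ[ℂ] b) y := by
  induction y with
  | zero => simp
  | add y y' hy hy' => rw [map_add, inner_add_right, inner_add_right, hy, hy', mul_add]
  | tmul F c =>
    have h : (mulBy α t f F : Ω.Cover → ℂ) x = f.1 x.clPt * F x := rfl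
    rw [tensorHom_tmul, TensorProduct.inner_tmul, TensorProduct.inner_tmul, RKHS.kerFun_inner,
      RKHS.kerFun_inner, h]
    simp [mul_assoc]

theorem inner_kerFun_kerFun (x y : Ω.Cover) :
    inner ℂ (RKHS.kerFun (HardySpace Ω α t) x (1 : ℂ)) (RKHS.kerFun (HardySpace Ω α t) y (1 : ℂ))
      = kernel Ω α t x y := by
  rw [RKHS.kerFun_inner, RKHS.kerFun_apply]
  simp [kernel]

end HardySpace

/-! ### Gram matrices and the dilation -/

open scoped ComplexOrder in
/-- A positive semidefinite matrix is a Gram matrix; the order of the indices is the one in which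
`⟪b j, b i⟫` is linear in `b i`. -/
theorem Matrix.PosSemidef.exists_inner_eq {n : ℕ} {A : Matrix (Fin n) (Fin n) ℂ}
    (hA : A.PosSemidef) :
    ∃ b : Fin n → EuclideanSpace ℂ (Fin n), ∀ i j, A i j = inner ℂ (b j) (b i) := by
  open scoped MatrixOrder in
  obtain ⟨B, rfl⟩ := CStarAlgebra.nonneg_iff_eq_star_mul_self.1 hA.nonneg
  refine ⟨fun i => WithLp.toLp 2 fun k => star (B k i), fun i j => ?_⟩
  simp [Matrix.mul_apply, PiLp.inner_apply, Matrix.star_apply, mul_comm]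

/-- A linear map that preserves the Gram matrix of a basis is an isometry. -/
theorem Module.Basis.exists_linearIsometry {ι V H : Type*} [NormedAddCommGroup V]
    [InnerProductSpace ℂ V] [NormedAddCommGroup H] [InnerProductSpace ℂ H]
    (e : Module.Basis ι ℂ V) (k : ι → H)
    (h : ∀ i j, inner ℂ (k i) (k j) = inner ℂ (e i) (e j)) :
    ∃ Γ : V →ₗᵢ[ℂ] H, ∀ i, Γ (e i) = k i := by
  let L : V →ₗ[ℂ] H := e.constr ℂ k
  have hL : ∀ i, L (e i) = k i := e.constr_basis ℂ k
  have h1 : ∀ i y, inner ℂ (k i) (L y) = inner ℂ (e i) y := fun i y =>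
    LinearMap.congr_fun (e.ext (f₁ := (innerₛₗ ℂ (k i)).comp L) (f₂ := innerₛₗ ℂ (e i)) fun j => by
      simp [hL, h]) y
  refine ⟨L.isometryOfInner fun x y => ?_, hL⟩
  exact LinearMap.congr_fun (e.ext (f₁ := (innerₛₗ ℂ (L x)).comp L) (f₂ := innerₛₗ ℂ x) fun i => by
    rw [LinearMap.comp_apply, hL, innerₛₗ_apply_apply, innerₛₗ_apply_apply, ← inner_conj_symm, h1,
      inner_conj_symm]) y

/-- By conjugate linearity, a dilation need only be tested against the vectors of a basis. -/
theorem PlanarDomain.dilatesTo_of_basis {m : ℕ} {Ω : PlanarDomain m} {ι V H : Type*}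
    [NormedAddCommGroup V] [InnerProductSpace ℂ V] [NormedAddCommGroup H] [InnerProductSpace ℂ H]
    {ρ : Ω.planarAlgebra →ₐ[ℂ] (V →L[ℂ] V)} {ρ' : Ω.planarAlgebra →ₐ[ℂ] (H →L[ℂ] H)}
    (e : Module.Basis ι ℂ V) (Γ : V →ₗᵢ[ℂ] H)
    (h : ∀ f u i, inner ℂ (Γ (e i)) (ρ' f (Γ u)) = inner ℂ (e i) (ρ f u)) : DilatesTo ρ ρ' := by
  refine ⟨Γ, fun f u w => ?_⟩
  induction e.mem_span w using Submodule.span_induction with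
  | mem w hw =>
    obtain ⟨i, rfl⟩ := hw
    exact h f u i
  | zero => simp
  | add w w' _ _ hw hw' => rw [map_add, inner_add_left, inner_add_left, hw, hw']
  | smul c w _ hw => rw [map_smul, inner_smul_left, inner_smul_left, hw]

theorem mainTheorem6 {m n : ℕ} (Ω : PlanarDomain m) (t : Ω.carrier) (α : Fin m → Circle)
    {V : Type*} [NormedAddCommGroup V] [InnerProductSpace ℂ V] [FiniteDimensional ℂ V]
    (hV : Module.finrank ℂ V = n) (T : V →L[ℂ] V)
    (z : Fin n → ℂ) (hz : Function.Injective z) (hzΩ : ∀ i, z i ∈ Ω.carrier)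
    (hT : ∀ i, Module.End.HasEigenvalue (T : V →ₗ[ℂ] V) (z i))
    (v : Fin n → V)
    (hv : ∀ i, Module.End.HasEigenvector (LinearMap.adjoint (T : V →ₗ[ℂ] V))
      (starRingEnd ℂ (z i)) (v i))
    (x : Fin n → Ω.Cover) (hx : ∀ i, (x i).pt = z i)
    (A : Matrix (Fin n) (Fin n) ℂ) (hA : A.PosSemidef)
    (hK : (Matrix.of fun i j => inner ℂ (v j) (v i)) =
      A ⊙ (Matrix.of fun i j => HardySpace.kernel Ω α t (x j) (x i))) :
    ∃ (ρT : Ω.planarAlgebra →ₐ[ℂ] (V →L[ℂ] V))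
      (ρM : Ω.planarAlgebra →ₐ[ℂ]
        ((HardySpace Ω α t ⊗[ℂ] EuclideanSpace ℂ (Fin n)) →L[ℂ]
          (HardySpace Ω α t ⊗[ℂ] EuclideanSpace ℂ (Fin n)))),
      PlanarDomain.IsInducedBy ρT T ∧
      PlanarDomain.IsInducedBy ρM (HardySpace.mulZTensor Ω α t n) ∧
      PlanarDomain.DilatesTo ρT ρM := by
  subst hV
  -- the eigenvectors of `T*` belong to distinct eigenvalues and are `dim V` in number
  have hli : LinearIndependent ℂ v := Module.End.eigenvectors_linearIndependent' _
    (fun i => starRingEnd ℂ (z i)) ((starRingEnd ℂ).injective.comp hz) v hv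
  let e : Module.Basis (Fin (Module.finrank ℂ V)) ℂ V :=
    basisOfLinearIndependentOfCardEqFinrank' v hli (by simp)
  have he : ⇑e = v := coe_basisOfLinearIndependentOfCardEqFinrank' v hli (by simp)
  -- the coordinates `u ↦ ⟪v i, u⟫`
  let φ : V →ₗ[ℂ] (Fin (Module.finrank ℂ V) → ℂ) := LinearMap.pi fun i => innerₛₗ ℂ (v i)
  have hφ : ∀ u i, φ u i = inner ℂ (v i) u := fun u i => rfl
  have hφinj : Function.Injective φ := by
    refine (injective_iff_map_eq_zero φ).2 fun u hu =>
      InnerProductSpace.ext_inner_left_basis e fun i => ?_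
    rw [he, inner_zero_right, ← hφ, hu, Pi.zero_apply]
  let Φ : V ≃ₗ[ℂ] (Fin (Module.finrank ℂ V) → ℂ) :=
    LinearEquiv.ofInjectiveOfFinrankEq φ hφinj (by simp)
  have hΦ : ∀ u i, Φ u i = inner ℂ (v i) u := fun u i => rfl
  let ρT := PlanarDomain.diagonalHom Φ fun i => (x i).clPt
  have hρT : ∀ f u i, inner ℂ (v i) (ρT f u) = f.1 (x i).clPt * inner ℂ (v i) u := fun f u i =>
    PlanarDomain.diagonalHom_apply Φ _ f u i
  refine ⟨ρT, HardySpace.tensorHom α t _, ?_, HardySpace.isInducedBy_tensorHom _, ?_⟩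
  · refine PlanarDomain.isInducedBy_of_continuous _
      (PlanarDomain.continuous_diagonalHom Φ _) (ContinuousLinearMap.ext fun u => ?_)
    refine Φ.injective (funext fun i => ?_)
    have h1 : inner ℂ (v i) (T u) = z i * inner ℂ (v i) u := by
      rw [← T.coe_coe, ← LinearMap.adjoint_inner_left, (hv i).apply_eq_smul, inner_smul_left,
        Complex.conj_conj]
    rw [hΦ, hΦ, hρT, h1, ← hx i]
    simp [PlanarDomain.rat, PlanarDomain.ratFun, PlanarDomain.Cover.clPt]
  · obtain ⟨b, hb⟩ := hA.exists_inner_eq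
    obtain ⟨Γ, hΓ⟩ := e.exists_linearIsometry
      (fun i => RKHS.kerFun (HardySpace Ω α t) (x i) (1 : ℂ) ⊗ₜ[ℂ] b i) fun j i => by
        have h := congrFun₂ hK i j
        simp only [Matrix.of_apply, Matrix.hadamard_apply] at h
        rw [TensorProduct.inner_tmul, HardySpace.inner_kerFun_kerFun, he, h, hb, mul_comm]
    refine PlanarDomain.dilatesTo_of_basis e Γ fun f u i => ?_
    rw [hΓ, HardySpace.inner_kerFun_tmul_tensorHom, ← hΓ, Γ.inner_map_map, he, hρT]
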